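/- Let $G$ be a second countable, locally compact, Hausdorff topological groupoid with unit space $X=G^{(0)}$, range and source maps $r,s:G\to X$, fibres $G^x=r^{-1}(x)$, and a (continuous, left) Haar system $\lambda=(\lambda^x)_{x\in X}$. Let $\psi:G\to\mathbb R$ be a continuous function. Definitions. The function $\psi$ is *conditionally of negative type* if for every $x\in X$ the kernel $\psi_x(\gamma,\gamma')=\psi(\gamma^{-1}\gamma')$ on $G^x\times G^x$ vanishes on the diagonal, is symmetric, and satisfies $\sum_{i,j}\psi_x(\gamma_i,\gamma_j)\zeta_i\zeta_j\le 0$ for all $n\geq 1$, all $\gamma_1,\dots,\gamma_n\in G^x$ and all $\zeta_1,\dots,\zeta_n\in\mathbb R$ with $\sum_i\zeta_i=0$. A *real Hilbert bundle* $\vec E$ over $X$ is a Hausdorff space with a continuous open surjection onto $X$ whose fibres are real Hilbert spaces, such that the norm, the addition $\vec E*\vec E\to\vec E$ and the multiplication by each scalar are continuous, and such that any net $(a_i)$ in $\vec E$ with $\|a_i\|\to0$ whose base points converge to $x$ converges to $0_x$. An *affine real Hilbert bundle* $(E,\vec E)$ consists of a real Hilbert bundle $\vec E$ and a Hausdorff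 space $E$ with a continuous open surjection onto $X$, each fibre $E_x$ being an affine space with direction $\vec E_x$, such that $(u,a)\mapsto(u,u+a)$ is a homeomorphism $E*\vec E\to E*E$ of fibre products over $X$. A *continuous $G$-affine real Hilbert bundle* is an affine real Hilbert bundle over $X$ with a continuous action $G*E\to E$, where $G*E=\{(\gamma,u): u\in E_{s(\gamma)}\}$, in which each $\gamma$ acts by an affine isometry $A(\gamma)$ from $E_{s(\gamma)}$ onto $E_{r(\gamma)}$. An *isomorphism* of such bundles is a $G$-equivariant homeomorphism over the identity of $X$ which is an affine isometry on each fibre and whose linear part is a homeomorphism of the direction bundles. (A) The following conditions are equivalent: 1. $\psi$ is conditionally of negative type; 2. $\psi$ vanishes on $G^{(0)}$, $\psi(\gamma^{-1})=\psi(\gamma)$ for all $\gamma\in G$, and for all $x\in X$ and all $f\in C_c(G,\mathbb R)$ with $\int f\,d\lambda^x=0$, $$\int\!\!\int\psi(\gamma^{-1}\gamma')f(\gamma)f(\gamma')\,d\lambda^x(\gamma)\,d\lambda^x(\gamma')\le 0;$$ 3. there exist a continuous $G$-affine real Hilbert bundle $E$ and a continuous section $e:X\to E$ such that $\psi(\gamma)=\|e(r(\gamma))-A(\gamma)e(s(\gamma))\|^2$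 for all $\gamma\in G$. (B) Suppose that $\psi$ is conditionally of negative type. Then: 1. there exist a continuous $G$-affine real Hilbert bundle $E$ and a continuous section $e:X\to E$ such that (a) $\psi(\gamma)=\|e(r(\gamma))-A(\gamma)e(s(\gamma))\|^2$ for all $\gamma\in G$; (b) for every $x\in X$, the affine span of $\{A(\gamma)e(s(\gamma)):\gamma\in G^x\}$ is dense in $E_x$; 2. if $(E,e)$ and $(E',e')$ both satisfy the conditions of 1, there is a unique isomorphism $u:E\to E'$ of $G$-affine real Hilbert bundles such that $e'=u\circ e$. -/

import Mathlib

open CategoryTheory MeasureTheory Filter Topology Bundle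

universe u v w w₁ w₂

/-! ### Topological groupoids -/

/-- The set `G` of all arrows of a groupoid with unit space `X = G⁽⁰⁾`. An arrow `γ` goes from its
source `s(γ)` to its range `r(γ)`, and the product `γ γ'`, defined when `s(γ) = r(γ')`, is the
composition of `γ` after `γ'`, i.e. `γ' ≫ γ` in Mathlib's notation. -/
structure Arr (X : Type u) [Groupoid.{v} X] where
  src : X
  rng : X
  hom : src ⟶ rng

namespace Arr

variable {X : Type u} [Groupoid.{v} X]

/-- The unit at `x`. -/
def unit (x : X) : Arr X := ⟨x, x, 𝟙 x⟩

/-- The inverse arrow. -/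
def inv (γ : Arr X) : Arr X := ⟨γ.rng, γ.src, Groupoid.inv γ.hom⟩

/-- The product `γ γ'` of a composable pair. -/
def mul (γ γ' : Arr X) (h : γ.src = γ'.rng) : Arr X :=
  ⟨γ'.src, γ.rng, γ'.hom ≫ eqToHom h.symm ≫ γ.hom⟩

end Arr

/-- A groupoid with topologies on the set of units and on the set of arrows is a topological
groupoid if all structure maps are continuous. (As `unit` is then a homeomorphism onto its range,
with inverse `rng`, the unit space carries the topology of a subspace of the arrow space.) -/
class IsTopologicalGroupoid (X : Type u) [Groupoid.{v} X] [TopologicalSpace X]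
    [TopologicalSpace (Arr X)] : Prop where
  continuous_src : Continuous (Arr.src : Arr X → X)
  continuous_rng : Continuous (Arr.rng : Arr X → X)
  continuous_unit : Continuous (Arr.unit : X → Arr X)
  continuous_inv : Continuous (Arr.inv : Arr X → Arr X)
  continuous_mul : Continuous
    (fun p : {p : Arr X × Arr X // p.1.src = p.2.rng} => Arr.mul p.1.1 p.1.2 p.2)

/-- The range fibre `Gˣ` of all arrows with range `x`. -/
structure RFib {X : Type u} [Groupoid.{v} X] (x : X) where
  src : X
  hom : src ⟶ x

namespace RFib

variable {X : Type u} [Groupoid.{v} X]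

/-- The inclusion of `Gˣ` in `G`. -/
def toArr {x : X} (γ : RFib x) : Arr X := ⟨γ.src, x, γ.hom⟩

/-- `γ⁻¹ γ'` for `γ, γ'` in `Gˣ`. -/
def invMul {x : X} (γ γ' : RFib x) : Arr X := ⟨γ'.src, γ.src, γ'.hom ≫ Groupoid.inv γ.hom⟩

/-- Left translation `γ' ↦ γ γ'` by an arrow `γ` from `x` to `y`. -/
def lmul {x y : X} (γ : x ⟶ y) (γ' : RFib x) : RFib y := ⟨γ'.src, γ'.hom ≫ γ⟩

/-- `Gˣ` has the subspace topology. -/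
instance [TopologicalSpace (Arr X)] (x : X) : TopologicalSpace (RFib x) :=
  TopologicalSpace.induced toArr inferInstance

instance [TopologicalSpace (Arr X)] (x : X) : MeasurableSpace (RFib x) := borel _

instance [TopologicalSpace (Arr X)] (x : X) : BorelSpace (RFib x) := ⟨rfl⟩

end RFib

/-- A (continuous, left) Haar system: a family `λˣ` of measures on the fibres `Gˣ`, finite on
compact sets and of full support, such that `x ↦ ∫ f dλˣ` is continuous for `f ∈ C_c(G)`, and
invariant under left translations. (On a second countable locally compact Hausdorff groupoid
such measures are automatically Radon.) -/
structure HaarSystem (X : Type u) [Groupoid.{v} X] [TopologicalSpace X]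
    [TopologicalSpace (Arr X)] where
  meas : ∀ x : X, Measure (RFib x)
  finite_on_compacts : ∀ x, IsFiniteMeasureOnCompacts (meas x)
  full_support : ∀ x, (meas x).IsOpenPosMeasure
  continuous_integral : ∀ f : Arr X → ℝ, Continuous f → HasCompactSupport f →
    Continuous fun x => ∫ γ, f (RFib.toArr γ) ∂(meas x)
  map_lmul : ∀ {x y : X} (γ : x ⟶ y), (meas x).map (RFib.lmul γ) = meas y

/-! ### Functions conditionally of negative type -/

/-- Kernels conditionally of negative type on a set. -/
structure IsCNTKernel {Y : Type*} (k : Y → Y → ℝ) : Prop where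
  diag : ∀ y, k y y = 0
  symm : ∀ y z, k z y = k y z
  nonpos : ∀ (n : ℕ) (c : Fin n → ℝ) (y : Fin n → Y), ∑ i, c i = 0 →
    ∑ i, ∑ j, k (y i) (y j) * c i * c j ≤ 0

/-- Functions conditionally of negative type on a groupoid: for every unit `x`, the kernel
`(γ, γ') ↦ ψ(γ⁻¹ γ')` on `Gˣ` is conditionally of negative type. -/
def IsCNT {X : Type u} [Groupoid.{v} X] (ψ : Arr X → ℝ) : Prop :=
  ∀ x : X, IsCNTKernel fun γ γ' : RFib x => ψ (RFib.invMul γ γ')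

/-- The integral form of the condition, with respect to a Haar system. -/
structure IsIntegrallyCNT {X : Type u} [Groupoid.{v} X] [TopologicalSpace X]
    [TopologicalSpace (Arr X)] (lam : HaarSystem X) (ψ : Arr X → ℝ) : Prop where
  unit : ∀ x, ψ (Arr.unit x) = 0
  symm : ∀ γ : Arr X, ψ γ.inv = ψ γ
  nonpos : ∀ (x : X) (f : Arr X → ℝ), Continuous f → HasCompactSupport f →
    ∫ γ, f (RFib.toArr γ) ∂(lam.meas x) = 0 →
    ∫ γ, ∫ γ', ψ (RFib.invMul γ γ') * f (RFib.toArr γ) * f (RFib.toArr γ')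
      ∂(lam.meas x) ∂(lam.meas x) ≤ 0

/-! ### Hilbert bundles and affine Hilbert bundles -/

/-- The total space of a family of fibres over `X`. (Mathlib's total space carries a model fibre as
a phantom parameter; the bundles here are not assumed locally trivial and have no model fibre,
so it is set to `Unit`. There is no preferred topology on it; fibre products and pull-backs
carry the subspace topologies of Mathlib.) -/
abbrev Tot {X : Type*} (E : X → Type*) := TotalSpace Unit E

/-- Continuous real Hilbert bundles in the sense of Fell and Doran: the projection of the
(Hausdorff) total space is a continuous open surjection, each fibre is a real Hilbert space, the
norm and the operations are continuous, and the norm controls convergence to the zero vectors. -/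
structure IsHilbertBundle {X : Type u} [TopologicalSpace X] (V : X → Type w)
    [∀ x, NormedAddCommGroup (V x)] [∀ x, InnerProductSpace ℝ (V x)] [∀ x, CompleteSpace (V x)]
    [TopologicalSpace (Tot V)] : Prop where
  t2 : T2Space (Tot V)
  continuous_proj : Continuous fun a : Tot V => a.proj
  isOpenMap_proj : IsOpenMap fun a : Tot V => a.proj
  continuous_norm : Continuous fun a : Tot V => ‖a.snd‖
  continuous_add : Continuous
    fun p : TotalSpace (Unit × Unit) (V ×ᵇ V) => (⟨p.proj, p.snd.1 + p.snd.2⟩ : Tot V)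
  continuous_smul : ∀ c : ℝ, Continuous fun a : Tot V => (⟨a.proj, c • a.snd⟩ : Tot V)
  le_nhds_zero : ∀ (x : X) (l : Filter (Tot V)), Tendsto (fun a => a.proj) l (𝓝 x) →
    Tendsto (fun a => ‖a.snd‖) l (𝓝 0) → l ≤ 𝓝 (⟨x, 0⟩ : Tot V)

/-- Affine real Hilbert bundles `(E, V)`: `V` is a real Hilbert bundle, the projection of the
(Hausdorff) total space of `E` is a continuous open surjection, each fibre `E x` is an affine
space with direction `V x`, and `(p, a) ↦ (p, p + a)` is a homeomorphism from the fibre product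
`E * V` onto the fibre product `E * E`. -/
structure IsAffineHilbertBundle {X : Type u} [TopologicalSpace X] (V : X → Type w)
    [∀ x, NormedAddCommGroup (V x)] [∀ x, InnerProductSpace ℝ (V x)] [∀ x, CompleteSpace (V x)]
    [TopologicalSpace (Tot V)] (E : X → Type w) [∀ x, MetricSpace (E x)]
    [∀ x, NormedAddTorsor (V x) (E x)] [TopologicalSpace (Tot E)] : Prop where
  direction : IsHilbertBundle V
  t2 : T2Space (Tot E)
  continuous_proj : Continuous fun p : Tot E => p.proj
  isOpenMap_proj : IsOpenMap fun p : Tot E => p.proj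
  isHomeomorph_vadd : IsHomeomorph
    (fun p : TotalSpace (Unit × Unit) (E ×ᵇ V) =>
      (⟨p.proj, (p.snd.1, p.snd.2 +ᵥ p.snd.1)⟩ : TotalSpace (Unit × Unit) (E ×ᵇ E)))

/-- A continuous `G`-affine real Hilbert bundle: an affine real Hilbert bundle over the unit space
with a continuous action of `G` in which each arrow `γ` acts by an affine isometry
`A(γ) : E_{s(γ)} → E_{r(γ)}`. -/
structure GAffineHilbertBundle (X : Type u) [Groupoid.{v} X] [TopologicalSpace X]
    [TopologicalSpace (Arr X)] where
  dir : X → Type w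
  fib : X → Type w
  [normed : ∀ x, NormedAddCommGroup (dir x)]
  [inner : ∀ x, InnerProductSpace ℝ (dir x)]
  [complete : ∀ x, CompleteSpace (dir x)]
  [metric : ∀ x, MetricSpace (fib x)]
  [torsor : ∀ x, NormedAddTorsor (dir x) (fib x)]
  [topDir : TopologicalSpace (Tot dir)]
  [topFib : TopologicalSpace (Tot fib)]
  isAffineHilbertBundle : IsAffineHilbertBundle dir fib
  A : ∀ {x y : X}, (x ⟶ y) → (fib x ≃ᵃⁱ[ℝ] fib y)
  A_id : ∀ (x : X) (p : fib x), A (𝟙 x) p = p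
  A_mul : ∀ {x y z : X} (γ' : x ⟶ y) (γ : y ⟶ z) (p : fib x), A (γ' ≫ γ) p = A γ (A γ' p)
  /-- Continuity of the action map `(γ, p) ↦ A(γ) p` on `G * E = s*E`. -/
  continuous_A : Continuous fun q : Tot (Arr.src *ᵖ fib) =>
    (⟨q.proj.rng, A q.proj.hom q.snd⟩ : Tot fib)

namespace GAffineHilbertBundle

attribute [instance] normed inner complete metric torsor topDir topFib

variable {X : Type u} [Groupoid.{v} X] [TopologicalSpace X] [TopologicalSpace (Arr X)]

/-- Continuity of a section. -/
def IsContinuousSection (E : GAffineHilbertBundle.{u, v, w} X) (e : ∀ x, E.fib x) : Prop :=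
  Continuous fun x => (⟨x, e x⟩ : Tot E.fib)

/-- `ψ(γ) = ‖e(r(γ)) - A(γ) e(s(γ))‖²` for all arrows `γ`. -/
def Represents (E : GAffineHilbertBundle.{u, v, w} X) (e : ∀ x, E.fib x) (ψ : Arr X → ℝ) : Prop :=
  ∀ γ : Arr X, ψ γ = ‖e γ.rng -ᵥ E.A γ.hom (e γ.src)‖ ^ 2

/-- The affine span of all `A(γ) e(s(γ))`, `γ ∈ Gˣ`, is dense in `E_x`, for every unit `x`. -/
def IsGenerating (E : GAffineHilbertBundle.{u, v, w} X) (e : ∀ x, E.fib x) : Prop :=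
  ∀ x : X, Dense
    (affineSpan ℝ (Set.range fun γ : RFib x => E.A γ.hom (e γ.src)) : Set (E.fib x))

/-- Isomorphisms of `G`-affine real Hilbert bundles: `G`-equivariant bundle homeomorphisms over the
identity of the unit space that are affine isometries on the fibres (with linear parts forming
a homeomorphism of the direction bundles). -/
structure Iso (E : GAffineHilbertBundle.{u, v, w₁} X) (E' : GAffineHilbertBundle.{u, v, w₂} X) where
  map : ∀ x, E.fib x ≃ᵃⁱ[ℝ] E'.fib x
  isHomeomorph : IsHomeomorph fun p : Tot E.fib => (⟨p.proj, map p.proj p.snd⟩ : Tot E'.fib)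
  isHomeomorph_linear : IsHomeomorph fun a : Tot E.dir =>
    (⟨a.proj, (map a.proj).linearIsometryEquiv a.snd⟩ : Tot E'.dir)
  equivariant : ∀ {x y : X} (γ : x ⟶ y) (p : E.fib x), map y (E.A γ p) = E'.A γ (map x p)

end GAffineHilbertBundle

/-! ### Kernels conditionally of negative type and Hilbert spaces -/

namespace IsCNTKernel

/-! Over a single unit `x` this is Schoenberg's theorem: a kernel conditionally of negative type on
`Gˣ` is a squared distance `‖σ γ - σ γ'‖²` for a total family `σ` in a Hilbert space, normalised to
vanish at the unit (`IsCNTKernel.exists_hilbert`). The kernel `ψ(γ⁻¹γ')` is invariant under left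
translation, so `σ γ' ↦ σ (γγ')` preserves distances between families with dense affine span and
extends uniquely to an affine isometry `A(γ)` (`exists_affineIsometryEquiv_of_dist_eq`). Uniqueness
of the extension makes `A` functorial. With `e` the zero section, `A(γ) e(s(γ)) = σ γ`, which gives
both the formula for `ψ` and density.

The real work is the topology. Total spaces are topologised by base points, norms and inner products
with `σ` (`tendsto_sectionTopology_iff`). Totality of `σ` upgrades this to convergence of inner
products of arbitrary convergent families (`SectionwiseTendsto.tendsto_inner`), hence to the bundle
axioms. Approximation over one point must be carried to nearby points; this uses openness of the
range map, which the Haar system provides (`HaarSystem.isOpenMap_rng`). Conversely, in any Hilbert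
bundle a total continuous family determines convergence in the same way
(`IsHilbertBundle.tendsto_iff_sectionwise`), so the fibrewise isometries matching two generating
orbits are automatically homeomorphisms. This gives uniqueness.

A representation by a section makes `ψ(γ⁻¹γ')` a squared distance, hence of negative type. For the
integral form, the double integral is `-2‖∫ f σ‖²`; in the other direction, point masses are
approximated by normalised bump functions. -/

theorem sum_nonpos {Y : Type*} {k : Y → Y → ℝ} (hk : IsCNTKernel k) {ι : Type*} [Fintype ι]
    (c : ι → ℝ) (y : ι → Y) (hc : ∑ i, c i = 0) : ∑ i, ∑ j, k (y i) (y j) * c i * c j ≤ 0 := by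
  have e := (Fintype.equivFin ι).symm
  have h := hk.nonpos _ (c ∘ e) (y ∘ e) (by rw [← hc]; exact e.sum_comp c)
  simp only [Function.comp_apply] at h
  rw [← e.sum_comp]
  refine (Finset.sum_congr rfl fun i _ => ?_).trans_le h
  exact (e.sum_comp fun j => k (y (e i)) (y j) * c (e i) * c j).symm

/-- The Gram kernel associated with a base point is positive semidefinite. -/
theorem gram_nonneg {Y : Type*} {k : Y → Y → ℝ} (hk : IsCNTKernel k) (y₀ : Y) {ι : Type*}
    [Fintype ι] (c : ι → ℝ) (y : ι → Y) :
    0 ≤ ∑ i, ∑ j, (k (y i) y₀ + k (y j) y₀ - k (y i) (y j)) / 2 * c i * c j := by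
  -- The base point receives the weight `-∑ c i`, which brings the total weight to zero.
  have h := hk.sum_nonpos (ι := Option ι) (fun o => o.elim (-∑ i, c i) c) (fun o => o.elim y₀ y)
    (by simp [Fintype.sum_option])
  simp only [Fintype.sum_option, Option.elim, hk.diag, Finset.sum_add_distrib] at h
  have h1 : ∀ i, k y₀ (y i) = k (y i) y₀ := fun i => hk.symm _ _
  simp only [h1] at h
  have e1 : ∑ i, k (y i) y₀ * -(∑ i, c i) * c i = -((∑ i, k (y i) y₀ * c i) * ∑ i, c i) := by
    have h2 : ∀ i, k (y i) y₀ * -(∑ i, c i) * c i = -(k (y i) y₀ * c i * ∑ i, c i) :=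
      fun i => by ring
    simp only [h2, Finset.sum_neg_distrib, ← Finset.sum_mul]
  have e2 : ∑ i, k (y i) y₀ * c i * -(∑ i, c i) = -((∑ i, k (y i) y₀ * c i) * ∑ i, c i) := by
    rw [← Finset.sum_mul]; ring
  have e3 : ∑ i, ∑ j, (k (y i) y₀ + k (y j) y₀ - k (y i) (y j)) / 2 * c i * c j
      = (∑ i, k (y i) y₀ * c i) * (∑ i, c i)
        - (∑ i, ∑ j, k (y i) (y j) * c i * c j) / 2 := by
    have a1 : ∑ i, ∑ j, k (y i) y₀ * c i * c j = (∑ i, k (y i) y₀ * c i) * ∑ i, c i := by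
      rw [Finset.sum_mul_sum]
    have a2 : ∑ i, ∑ j, k (y j) y₀ * c i * c j = (∑ i, k (y i) y₀ * c i) * ∑ i, c i := by
      rw [Finset.sum_comm, ← a1]
      exact Finset.sum_congr rfl fun i _ => Finset.sum_congr rfl fun j _ => by ring
    have a3 : ∑ i, ∑ j, (k (y i) y₀ + k (y j) y₀ - k (y i) (y j)) / 2 * c i * c j
        = (∑ i, ∑ j, k (y i) y₀ * c i * c j + ∑ i, ∑ j, k (y j) y₀ * c i * c j
          - ∑ i, ∑ j, k (y i) (y j) * c i * c j) / 2 := by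
      simp only [← Finset.sum_add_distrib, ← Finset.sum_sub_distrib, Finset.sum_div]
      exact Finset.sum_congr rfl fun i _ => Finset.sum_congr rfl fun j _ => by ring
    rw [a3, a1, a2]; ring
  rw [e1, e2] at h
  rw [e3]
  linarith

/-- Every kernel conditionally of negative type is the square of the distance of a total family of
vectors in a Hilbert space. -/
theorem exists_hilbert {Y : Type u} {k : Y → Y → ℝ} (hk : IsCNTKernel k) (y₀ : Y) :
    ∃ (H : Type u) (_ : NormedAddCommGroup H) (_ : InnerProductSpace ℝ H) (_ : CompleteSpace H)
      (h : Y → H), h y₀ = 0 ∧ (∀ y z, ‖h y - h z‖ ^ 2 = k y z) ∧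
      Dense (Submodule.span ℝ (Set.range h) : Set H) := by
  -- Polarisation together with `h y₀ = 0` forces this value of `⟨h y, h z⟩`; it is viewed as a
  -- scalar operator on `ℝ` to define a reproducing kernel space.
  let K : Matrix Y Y (ℝ →L[ℝ] ℝ) := .of fun y z =>
    ((k y y₀ + k z y₀ - k y z) / 2) • ContinuousLinearMap.id ℝ ℝ
  have hK : K.PosSemidef := by
    have htfae := (RKHS.posSemidef_tfae (K := K)).out 0 2
    refine htfae.mpr ?_
    refine ⟨?_, fun vv => ?_⟩
    · ext y z
      simp [K, ContinuousLinearMap.star_eq_adjoint,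
        ContinuousLinearMap.adjoint_id, hk.symm y z, add_comm]
    · have h := hk.gram_nonneg y₀ (fun i : vv.support => vv i) (fun i => (i : Y))
      simp only [RCLike.re_to_real]
      refine h.trans_eq ?_
      simp only [Finsupp.sum]
      rw [← Finset.sum_coe_sort vv.support]
      refine Finset.sum_congr rfl fun i _ => ?_
      rw [← Finset.sum_coe_sort vv.support]
      refine Finset.sum_congr rfl fun j _ => ?_
      simp [K, hk.symm]
      ring
  have : Fact K.PosSemidef := ⟨hK⟩
  let H := RKHS.OfKernel K
  let h : Y → H := fun y => RKHS.kerFun H y (1 : ℝ)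
  have hin : ∀ y z, inner ℝ (h y) (h z) = (k y y₀ + k z y₀ - k y z) / 2 := by
    intro y z
    have := RKHS.kernel_inner H z y (1 : ℝ) (1 : ℝ)
    rw [RKHS.OfKernel.kernel_ofKernel] at this
    rw [← this]
    simp [K, hk.symm]
    ring
  refine ⟨H, inferInstance, inferInstance, inferInstance, h, ?_, fun y z => ?_, ?_⟩
  · rw [← inner_self_eq_zero (𝕜 := ℝ), hin, hk.diag]; simp
  · rw [@norm_sub_sq_real, ← real_inner_self_eq_norm_sq, ← real_inner_self_eq_norm_sq, hin, hin,
      hin, hk.diag, hk.diag]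
    ring
  · have := RKHS.kerFun_dense (H := H) (𝕜 := ℝ)
    rw [← Submodule.dense_iff_topologicalClosure_eq_top] at this
    refine this.mono (Submodule.span_le.mpr ?_)
    rintro _ ⟨y, c, rfl⟩
    have : RKHS.kerFun H y c = c • h y := by
      simp only [h]; rw [← map_smul, smul_eq_mul, mul_one]
    rw [this]
    exact Submodule.smul_mem _ _ (Submodule.subset_span ⟨y, rfl⟩)

end IsCNTKernel

/-! ### Squared distances and extension of isometries in affine Hilbert spaces -/

section Torsor

variable {V P : Type*} [NormedAddCommGroup V] [InnerProductSpace ℝ V] [MetricSpace P]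
  [NormedAddTorsor V P] {V' P' : Type*} [NormedAddCommGroup V'] [InnerProductSpace ℝ V']
  [MetricSpace P'] [NormedAddTorsor V' P']

theorem inner_vsub_vsub_eq_dist (a b c : P) :
    inner ℝ (a -ᵥ c) (b -ᵥ c) = (dist a c ^ 2 + dist b c ^ 2 - dist a b ^ 2) / 2 := by
  have h := @norm_sub_sq_real V _ _ (a -ᵥ c) (b -ᵥ c)
  rw [vsub_sub_vsub_cancel_right] at h
  simp only [dist_eq_norm_vsub V]
  linarith

/-- When the weights sum to zero, the double sum collapses to `-2‖∑ c i • (p (y i) -ᵥ p (y i₀))‖²`.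
-/
theorem isCNTKernel_norm_vsub_sq {Y : Type*} (p : Y → P) :
    IsCNTKernel fun y z => ‖(p y -ᵥ p z : V)‖ ^ 2 where
  diag y := by simp
  symm y z := by rw [← dist_eq_norm_vsub, ← dist_eq_norm_vsub, dist_comm]
  nonpos n c y hc := by
    rcases isEmpty_or_nonempty (Fin n) with hn | ⟨⟨i₀⟩⟩
    · simp
    simp only [← dist_eq_norm_vsub]
    have h1 : ∀ i j, dist (p (y i)) (p (y j)) ^ 2 * c i * c j
        = (dist (p (y i)) (p (y i₀)) ^ 2 * c i) * c j + c i * (dist (p (y j)) (p (y i₀)) ^ 2 * c j)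
          - 2 * inner ℝ (c i • (p (y i) -ᵥ p (y i₀)) : V) (c j • (p (y j) -ᵥ p (y i₀))) := by
      intro i j
      rw [real_inner_smul_left, real_inner_smul_right, inner_vsub_vsub_eq_dist]
      ring
    simp only [h1, Finset.sum_sub_distrib, Finset.sum_add_distrib, ← Finset.sum_mul,
      ← Finset.mul_sum, hc, mul_zero, zero_mul, Finset.sum_const_zero, ← inner_sum, ← sum_inner]
    have := real_inner_self_nonneg (x := ∑ i, c i • (p (y i) -ᵥ p (y i₀) : V))
    linarith

theorem dense_affineSpan_range_iff {ι : Type*} (p : ι → P) (i₀ : ι) :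
    Dense (affineSpan ℝ (Set.range p) : Set P) ↔
      Dense (Submodule.span ℝ (Set.range fun i => p i -ᵥ p i₀) : Set V) := by
  have h : (affineSpan ℝ (Set.range p) : Set P) = IsometryEquiv.vaddConst (p i₀) ''
      (Submodule.span ℝ (Set.range fun i => p i -ᵥ p i₀) : Set V) := by
    ext x
    rw [← vectorSpan_range_eq_span_range_vsub_right ℝ p i₀, ← direction_affineSpan]
    constructor
    · intro hx
      exact ⟨x -ᵥ p i₀, AffineSubspace.vsub_mem_direction hx (mem_affineSpan ℝ ⟨i₀, rfl⟩), by simp⟩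
    · rintro ⟨a, ha, rfl⟩
      exact AffineSubspace.vadd_mem_of_mem_direction ha (mem_affineSpan ℝ ⟨i₀, rfl⟩)
  rw [h]
  refine ⟨fun hd => ?_, fun hd => (IsometryEquiv.vaddConst (p i₀)).surjective.denseRange.dense_image
    (IsometryEquiv.vaddConst (p i₀)).continuous hd⟩
  have := hd.preimage (IsometryEquiv.vaddConst (p i₀)).toHomeomorph.isOpenMap
  rwa [IsometryEquiv.coe_toHomeomorph, Set.preimage_image_eq _
    (IsometryEquiv.vaddConst (p i₀)).injective] at this

/-- Equal Gram matrices give formal linear combinations the same norm in `V` and `V'`; both images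
are dense, so the identity on combinations extends by continuity. -/
theorem exists_linearIsometryEquiv_of_inner_eq [CompleteSpace V] [CompleteSpace V'] {ι : Type*}
    (h : ι → V) (h' : ι → V') (hin : ∀ i j, inner ℝ (h i) (h j) = inner ℝ (h' i) (h' j))
    (hd : Dense (Submodule.span ℝ (Set.range h) : Set V))
    (hd' : Dense (Submodule.span ℝ (Set.range h') : Set V')) :
    ∃ φ : V ≃ₗᵢ[ℝ] V', ∀ i, φ (h i) = h' i := by
  let e₁ := Finsupp.linearCombination ℝ h
  let e₂ := Finsupp.linearCombination ℝ h'
  have hn : ∀ c : ι →₀ ℝ, ‖e₂ (LinearEquiv.refl ℝ (ι →₀ ℝ) c)‖ = ‖e₁ c‖ := by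
    intro c
    rw [LinearEquiv.refl_apply, ← sq_eq_sq₀ (norm_nonneg _) (norm_nonneg _),
      ← real_inner_self_eq_norm_sq, ← real_inner_self_eq_norm_sq]
    simp only [e₁, e₂, Finsupp.linearCombination_apply, Finsupp.sum_inner, Finsupp.inner_sum,
      real_inner_smul_left, real_inner_smul_right, hin]
  have d₁ : DenseRange e₁ := by
    rw [DenseRange, ← LinearMap.coe_range, Finsupp.range_linearCombination]; exact hd
  have d₂ : DenseRange e₂ := by
    rw [DenseRange, ← LinearMap.coe_range, Finsupp.range_linearCombination]; exact hd'
  refine ⟨(LinearEquiv.refl ℝ (ι →₀ ℝ)).extendOfIsometry e₁ e₂ d₁ d₂ hn, fun i => ?_⟩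
  have := LinearEquiv.extendOfIsometry_eq (LinearEquiv.refl ℝ (ι →₀ ℝ)) e₁ e₂ d₁ d₂ hn
    (Finsupp.single i 1)
  simpa [e₁, e₂] using this

/-- Choosing `p i₀` and `p' i₀` as origins reduces this to the linear case, since distances
determine the inner products of differences. -/
theorem exists_affineIsometryEquiv_of_dist_eq [CompleteSpace V] [CompleteSpace V'] {ι : Type*}
    [Nonempty ι] (p : ι → P) (p' : ι → P') (hdist : ∀ i j, dist (p i) (p j) = dist (p' i) (p' j))
    (hd : Dense (affineSpan ℝ (Set.range p) : Set P))
    (hd' : Dense (affineSpan ℝ (Set.range p') : Set P')) :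
    ∃ φ : P ≃ᵃⁱ[ℝ] P', ∀ i, φ (p i) = p' i := by
  obtain ⟨i₀⟩ := ‹Nonempty ι›
  obtain ⟨φ, hφ⟩ := exists_linearIsometryEquiv_of_inner_eq (fun i => p i -ᵥ p i₀)
    (fun i => p' i -ᵥ p' i₀) (fun i j => by simp only [inner_vsub_vsub_eq_dist, hdist])
    ((dense_affineSpan_range_iff p i₀).mp hd) ((dense_affineSpan_range_iff p' i₀).mp hd')
  refine ⟨((AffineIsometryEquiv.vaddConst ℝ (p i₀)).symm.trans φ.toAffineIsometryEquiv).trans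
    (AffineIsometryEquiv.vaddConst ℝ (p' i₀)), fun i => ?_⟩
  simp [hφ]

theorem AffineIsometryEquiv.ext_of_dense {ι : Type*} {p : ι → P}
    (hd : Dense (affineSpan ℝ (Set.range p) : Set P)) {φ φ' : P ≃ᵃⁱ[ℝ] P'}
    (h : ∀ i, φ (p i) = φ' (p i)) : φ = φ' := by
  have h1 : Set.EqOn φ φ' (affineSpan ℝ (Set.range p) : Set P) := by
    intro x hx
    refine affineSpan_induction (p := fun x => φ x = φ' x) hx ?_ ?_
    · rintro _ ⟨i, rfl⟩; exact h i
    · intro c a b d ha hb hd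
      have e1 := φ.toAffineEquiv.toAffineMap.map_vadd d (c • (a -ᵥ b))
      have e2 := φ'.toAffineEquiv.toAffineMap.map_vadd d (c • (a -ᵥ b))
      simp only [map_smul, AffineMap.linearMap_vsub, AffineEquiv.coe_toAffineMap,
        AffineIsometryEquiv.coe_toAffineEquiv] at e1 e2
      rw [e1, e2, ha, hb, hd]
  exact DFunLike.coe_injective (Continuous.ext_on hd φ.continuous φ'.continuous h1)

end Torsor

/-! ### Continuous families of sections and the topology of a Hilbert bundle -/

section FiberProduct

variable {X : Type*} {E E' : X → Type*} [TopologicalSpace (Tot E)] [TopologicalSpace (Tot E')]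

theorem tendsto_fiberProduct_iff {ι : Type*} {l : Filter ι}
    {p : ι → TotalSpace (Unit × Unit) (E ×ᵇ E')} {q : TotalSpace (Unit × Unit) (E ×ᵇ E')} :
    Tendsto p l (𝓝 q) ↔
      Tendsto (fun i => (⟨(p i).proj, (p i).snd.1⟩ : Tot E)) l (𝓝 ⟨q.proj, q.snd.1⟩) ∧
      Tendsto (fun i => (⟨(p i).proj, (p i).snd.2⟩ : Tot E')) l (𝓝 ⟨q.proj, q.snd.2⟩) := by
  rw [(FiberBundle.Prod.isInducing_diag Unit E Unit E').tendsto_nhds_iff, nhds_prod_eq,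
    tendsto_prod_iff']
  rfl

theorem continuous_fiberProduct_fst :
    Continuous fun p : TotalSpace (Unit × Unit) (E ×ᵇ E') => (⟨p.proj, p.snd.1⟩ : Tot E) :=
  continuous_fst.comp (FiberBundle.Prod.isInducing_diag Unit E Unit E').continuous

theorem continuous_fiberProduct_snd :
    Continuous fun p : TotalSpace (Unit × Unit) (E ×ᵇ E') => (⟨p.proj, p.snd.2⟩ : Tot E') :=
  continuous_snd.comp (FiberBundle.Prod.isInducing_diag Unit E Unit E').continuous

end FiberProduct

/-! ### Lifting limit points along an open projection -/

section Lift

variable {X : Type*} {F : X → Type*} [TopologicalSpace (Tot F)] {ι : Type*}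

/-- The pairs of an index `i` and a point of `F` over `x i`, as `i` tends to its limit and the
point tends to `γ`. -/
def liftFilter (l : Filter ι) (x : ι → X) {x₀ : X} (γ : F x₀) : Filter (Σ i, F (x i)) :=
  comap Sigma.fst l ⊓ comap (fun p => (⟨x p.1, p.2⟩ : Tot F)) (𝓝 ⟨x₀, γ⟩)

theorem tendsto_fst_liftFilter (l : Filter ι) (x : ι → X) {x₀ : X} (γ : F x₀) :
    Tendsto Sigma.fst (liftFilter l x γ) l :=
  tendsto_comap.mono_left inf_le_left

theorem tendsto_snd_liftFilter (l : Filter ι) (x : ι → X) {x₀ : X} (γ : F x₀) :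
    Tendsto (fun p => (⟨x p.1, p.2⟩ : Tot F)) (liftFilter l x γ) (𝓝 ⟨x₀, γ⟩) :=
  tendsto_comap.mono_left inf_le_right

theorem tendsto_liftFilter {l : Filter ι} {x : ι → X} {x₀ : X} {γ : F x₀} {κ : Type*}
    {l' : Filter κ} {g : κ → ι} (hg : Tendsto g l' l) {γ' : ∀ k, F (x (g k))}
    (hγ' : Tendsto (fun k => (⟨x (g k), γ' k⟩ : Tot F)) l' (𝓝 ⟨x₀, γ⟩)) :
    Tendsto (fun k => (⟨g k, γ' k⟩ : Σ i, F (x i))) l' (liftFilter l x γ) :=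
  tendsto_inf.mpr ⟨tendsto_comap_iff.mpr hg, tendsto_comap_iff.mpr hγ'⟩

/-- Finitely many points over the limit of `x` can be lifted along `x`, after a refinement of the
index set, if the projection is open. -/
theorem exists_lift [TopologicalSpace X] (hopen : IsOpenMap fun a : Tot F => a.proj)
    {l : Filter ι} {x : ι → X} {x₀ : X} (hx : Tendsto x l (𝓝 x₀)) {κ : Type*} [Finite κ]
    (γ : κ → F x₀) :
    ∃ l' : Filter (Σ i, κ → F (x i)), map Sigma.fst l' = l ∧
      ∀ j, Tendsto (fun p => (⟨x p.1, p.2 j⟩ : Tot F)) l' (𝓝 ⟨x₀, γ j⟩) := by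
  -- The coarsest filter with the required limits. Openness is needed only for its image to be all
  -- of `l`, so that limits along `l` can be tested after lifting.
  refine ⟨comap Sigma.fst l ⊓ ⨅ j, comap (fun p => (⟨x p.1, p.2 j⟩ : Tot F)) (𝓝 ⟨x₀, γ j⟩),
    le_antisymm (tendsto_comap.mono_left inf_le_left) ?_, fun j =>
      tendsto_comap.mono_left (inf_le_right.trans (iInf_le _ j))⟩
  intro S hS
  obtain ⟨A, hA, B, hB, hAB⟩ := mem_inf_iff.mp (mem_map.mp hS)
  obtain ⟨A', hA', hAA'⟩ := mem_comap.mp hA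
  obtain ⟨t, ht, rfl⟩ := (mem_iInf_of_finite _).mp hB
  choose N hN hNt using fun j => mem_comap.mp (ht j)
  have h1 : ∀ j, ∀ᶠ i in l, ∃ γ' : F (x i), (⟨x i, γ'⟩ : Tot F) ∈ N j := by
    intro j
    filter_upwards [hx (hopen.image_mem_nhds (hN j))] with i hi
    obtain ⟨⟨y, g⟩, hg, hy⟩ := hi
    change y = x i at hy
    subst hy
    exact ⟨g, hg⟩
  filter_upwards [hA', eventually_all.mpr h1] with i hi hj
  choose γ' hγ' using hj
  have : (⟨i, γ'⟩ : Σ i, κ → F (x i)) ∈ A ∩ ⋂ j, t j :=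
    ⟨hAA' hi, Set.mem_iInter.mpr fun j => hNt j (hγ' j)⟩
  rw [← hAB] at this
  exact this

end Lift

/-! ### The topology defined by a total family of sections -/

section Sections

variable {X : Type*} {F : X → Type*} [TopologicalSpace (Tot F)]
  {V : X → Type*} [∀ x, NormedAddCommGroup (V x)] [∀ x, InnerProductSpace ℝ (V x)]
  {σ : ∀ x, F x → V x}

theorem tendsto_inner_sections
    (hσ : Continuous fun p : TotalSpace (Unit × Unit) (F ×ᵇ F) =>
      inner ℝ (σ p.proj p.snd.1) (σ p.proj p.snd.2))
    {ι : Type*} {l : Filter ι} {x : ι → X} {γ γ' : ∀ i, F (x i)} {x₀ : X} {γ₀ γ₀' : F x₀}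
    (h : Tendsto (fun i => (⟨x i, γ i⟩ : Tot F)) l (𝓝 ⟨x₀, γ₀⟩))
    (h' : Tendsto (fun i => (⟨x i, γ' i⟩ : Tot F)) l (𝓝 ⟨x₀, γ₀'⟩)) :
    Tendsto (fun i => inner ℝ (σ (x i) (γ i)) (σ (x i) (γ' i))) l
      (𝓝 (inner ℝ (σ x₀ γ₀) (σ x₀ γ₀'))) :=
  (hσ.tendsto ⟨x₀, (γ₀, γ₀')⟩).comp
    (tendsto_fiberProduct_iff (p := fun i => ⟨x i, (γ i, γ' i)⟩).mpr ⟨h, h'⟩)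

/-- The expansion of `‖σ γ - σ γ'‖²` into inner products is continuous on the fibre product and
vanishes on the diagonal. -/
theorem exists_nhds_norm_sub_lt
    (hσ : Continuous fun p : TotalSpace (Unit × Unit) (F ×ᵇ F) =>
      inner ℝ (σ p.proj p.snd.1) (σ p.proj p.snd.2))
    {x₀ : X} (γ₀ : F x₀) {ε : ℝ} (hε : 0 < ε) :
    ∃ U ∈ 𝓝 (⟨x₀, γ₀⟩ : Tot F), ∀ (x : X) (γ γ' : F x), (⟨x, γ⟩ : Tot F) ∈ U →
      (⟨x, γ'⟩ : Tot F) ∈ U → ‖σ x γ - σ x γ'‖ < ε := by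
  have h1 := tendsto_fiberProduct_iff.mp
    (tendsto_id (x := 𝓝 (⟨x₀, (γ₀, γ₀)⟩ : TotalSpace (Unit × Unit) (F ×ᵇ F))))
  have h2 : Tendsto (fun p : TotalSpace (Unit × Unit) (F ×ᵇ F) =>
      ‖σ p.proj p.snd.1 - σ p.proj p.snd.2‖ ^ 2) (𝓝 ⟨x₀, (γ₀, γ₀)⟩) (𝓝 0) := by
    have h3 := ((tendsto_inner_sections hσ h1.1 h1.1).sub
      ((tendsto_inner_sections hσ h1.1 h1.2).const_mul 2)).add
      (tendsto_inner_sections hσ h1.2 h1.2)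
    simp only [real_inner_self_eq_norm_sq, id] at h3
    simp only [@norm_sub_sq_real]
    convert h3 using 2
    ring
  have h4 := h2.eventually (gt_mem_nhds (show (0 : ℝ) < ε ^ 2 by positivity))
  rw [(FiberBundle.Prod.isInducing_diag Unit F Unit F).nhds_eq_comap, eventually_comap,
    nhds_prod_eq] at h4
  obtain ⟨P, hP, h⟩ := mem_prod_self_iff.mp h4
  exact ⟨P, hP, fun x γ γ' hγ hγ' =>
    lt_of_pow_lt_pow_left₀ 2 hε.le (h (Set.mk_mem_prod hγ hγ') ⟨x, (γ, γ')⟩ rfl)⟩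

/-- Approximation by finite linear combinations of a total family. -/
theorem exists_norm_sub_sum_lt {H : Type*} [NormedAddCommGroup H] [InnerProductSpace ℝ H]
    {Y : Type*} {h : Y → H} (hd : Dense (Submodule.span ℝ (Set.range h) : Set H)) (v : H) {ε : ℝ}
    (hε : 0 < ε) : ∃ (s : Finset Y) (c : Y → ℝ), ‖v - ∑ y : s, c y • h y‖ < ε := by
  obtain ⟨w, hw, hvw⟩ := hd.exists_dist_lt v hε
  obtain ⟨c, rfl⟩ := Finsupp.mem_span_range_iff_exists_finsupp.mp hw
  refine ⟨c.support, c, ?_⟩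
  rw [dist_eq_norm, Finsupp.sum] at hvw
  rwa [Finset.sum_coe_sort c.support fun y => c y • h y]

variable [TopologicalSpace X]

/-- The base points converge, the norms converge and the inner products with the family `σ`
converge. -/
structure SectionwiseTendsto (σ : ∀ x, F x → V x) {ι : Type*} (l : Filter ι) (x : ι → X)
    (s : ∀ i, V (x i)) {x₀ : X} (v : V x₀) : Prop where
  tendsto_base : Tendsto x l (𝓝 x₀)
  tendsto_norm : Tendsto (fun i => ‖s i‖) l (𝓝 ‖v‖)
  tendsto_section : ∀ γ : F x₀, Tendsto (fun p : Σ i, F (x i) => inner ℝ (s p.1) (σ (x p.1) p.2))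
    (liftFilter l x γ) (𝓝 (inner ℝ v (σ x₀ γ)))

/-- The topology on the total space of a family of Hilbert spaces determined by a family `σ`. -/
@[reducible] def sectionTopology (σ : ∀ x, F x → V x) : TopologicalSpace (Tot V) :=
  TopologicalSpace.induced (fun a => a.proj) inferInstance ⊓
  TopologicalSpace.induced (fun a => ‖a.snd‖) inferInstance ⊓
  TopologicalSpace.generateFrom {S | ∃ (U : Set (Tot F)) (O : Set ℝ), IsOpen U ∧ IsOpen O ∧
    S = {a | ∃ γ : F a.proj, (⟨a.proj, γ⟩ : Tot F) ∈ U ∧ inner ℝ a.snd (σ a.proj γ) ∈ O}}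

theorem SectionwiseTendsto.comp {ι : Type*} {l : Filter ι} {x : ι → X}
    {s : ∀ i, V (x i)} {x₀ : X} {v : V x₀} (h : SectionwiseTendsto σ l x s v) {κ : Type*}
    {l' : Filter κ} {g : κ → ι} (hg : Tendsto g l' l) {γ : F x₀} {γ' : ∀ k, F (x (g k))}
    (hγ' : Tendsto (fun k => (⟨x (g k), γ' k⟩ : Tot F)) l' (𝓝 ⟨x₀, γ⟩)) :
    Tendsto (fun k => inner ℝ (s (g k)) (σ (x (g k)) (γ' k))) l' (𝓝 (inner ℝ v (σ x₀ γ))) :=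
  (h.tendsto_section γ).comp (tendsto_liftFilter hg hγ')

/-- The subbasic sets ask for one `γ` in `U` with a good inner product, the sectionwise condition
for all `γ` near the limit. Nearby `γ` have nearby `σ γ`, and the norms `‖s i‖` are eventually
bounded, so one implies all. For the converse, openness supplies a nearby `γ`. -/
theorem tendsto_sectionTopology_iff (hopen : IsOpenMap fun a : Tot F => a.proj)
    (hσ : Continuous fun p : TotalSpace (Unit × Unit) (F ×ᵇ F) =>
      inner ℝ (σ p.proj p.snd.1) (σ p.proj p.snd.2))
    [t : TopologicalSpace (Tot V)] (ht : t = sectionTopology σ)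
    {ι : Type*} {l : Filter ι} {x : ι → X} {s : ∀ i, V (x i)} {x₀ : X} {v : V x₀} :
    Tendsto (fun i => (⟨x i, s i⟩ : Tot V)) l (𝓝 ⟨x₀, v⟩) ↔ SectionwiseTendsto σ l x s v := by
  subst ht
  rw [sectionTopology, nhds_inf, nhds_inf, tendsto_inf, tendsto_inf, nhds_induced, nhds_induced,
    tendsto_comap_iff, tendsto_comap_iff, TopologicalSpace.tendsto_nhds_generateFrom_iff]
  constructor
  · rintro ⟨⟨h1, h2⟩, h3⟩
    refine ⟨h1, h2, fun γ => Metric.tendsto_nhds.mpr fun ε hε => ?_⟩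
    have hM : 0 < ‖v‖ + 1 := by positivity
    obtain ⟨U, hU, hUσ⟩ := exists_nhds_norm_sub_lt hσ γ
      (show 0 < ε / (2 * (‖v‖ + 1)) by positivity)
    obtain ⟨U', hU', hUo, hmem⟩ := mem_nhds_iff.mp hU
    have h4 := h3 _ ⟨U', Metric.ball (inner ℝ v (σ x₀ γ)) (ε / 2), hUo, Metric.isOpen_ball, rfl⟩
      ⟨γ, hmem, Metric.mem_ball_self (by positivity)⟩
    have h5 : ∀ᶠ i in l, ‖s i‖ < ‖v‖ + 1 := h2.eventually (gt_mem_nhds (lt_add_one _))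
    filter_upwards [(tendsto_fst_liftFilter l x γ).eventually h4,
      (tendsto_fst_liftFilter l x γ).eventually h5, (tendsto_snd_liftFilter l x γ) hU]
      with ⟨i, γ'⟩ h6 h7 h8
    obtain ⟨γ'', hγ'', h9⟩ := h6
    have h10 := hUσ _ γ' γ'' h8 (hU' hγ'')
    have h11 : |inner ℝ (s i) (σ (x i) γ') - inner ℝ (s i) (σ (x i) γ'')| ≤ ε / 2 := by
      rw [← inner_sub_right]
      calc |inner ℝ (s i) (σ (x i) γ' - σ (x i) γ'')|
          ≤ ‖s i‖ * ‖σ (x i) γ' - σ (x i) γ''‖ := abs_real_inner_le_norm _ _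
        _ ≤ (‖v‖ + 1) * (ε / (2 * (‖v‖ + 1))) := by gcongr
        _ = ε / 2 := by field_simp
    rw [Metric.mem_ball, Real.dist_eq] at h9
    rw [Real.dist_eq]
    have := abs_sub_le (inner ℝ (s i) (σ (x i) γ')) (inner ℝ (s i) (σ (x i) γ''))
      (inner ℝ v (σ x₀ γ))
    linarith
  · intro h
    refine ⟨⟨h.tendsto_base, h.tendsto_norm⟩, ?_⟩
    rintro _ ⟨U, O, hU, hO, rfl⟩ ⟨γ, hγU, hγO⟩
    obtain ⟨l', hl', hγ'⟩ := exists_lift hopen h.tendsto_base (fun _ : Unit => γ)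
    have h1 := (hγ' ()).eventually (hU.mem_nhds hγU)
    have h2 := (h.comp (hl'.le : Tendsto Sigma.fst l' l) (hγ' ())).eventually (hO.mem_nhds hγO)
    rw [← hl', mem_map]
    filter_upwards [h1, h2] with p hp1 hp2
    exact ⟨p.2 (), hp1, hp2⟩

theorem SectionwiseTendsto.sum
    (hσ : Continuous fun p : TotalSpace (Unit × Unit) (F ×ᵇ F) =>
      inner ℝ (σ p.proj p.snd.1) (σ p.proj p.snd.2))
    {ι : Type*} {l : Filter ι} {x : ι → X} {x₀ : X} (hx : Tendsto x l (𝓝 x₀)) {κ : Type*}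
    [Fintype κ] (c : κ → ℝ) {γ : ∀ i, κ → F (x i)} {γ₀ : κ → F x₀}
    (hγ : ∀ j, Tendsto (fun i => (⟨x i, γ i j⟩ : Tot F)) l (𝓝 ⟨x₀, γ₀ j⟩)) :
    SectionwiseTendsto σ l x (fun i => ∑ j, c j • σ (x i) (γ i j)) (∑ j, c j • σ x₀ (γ₀ j)) where
  tendsto_base := hx
  tendsto_norm := by
    simp only [norm_eq_sqrt_real_inner, sum_inner, inner_sum, real_inner_smul_left,
      real_inner_smul_right]
    exact (tendsto_finsetSum _ fun i _ => tendsto_finsetSum _ fun j _ =>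
      ((tendsto_inner_sections hσ (hγ _) (hγ _)).const_mul _).const_mul _).sqrt
  tendsto_section γ' := by
    simp only [sum_inner, real_inner_smul_left]
    exact tendsto_finsetSum _ fun j _ => (tendsto_inner_sections hσ
      ((hγ j).comp (tendsto_fst_liftFilter l x γ')) (tendsto_snd_liftFilter l x γ')).const_mul _

/-- Replace `s'` by a lift `τ` of a finite combination of sections approximating `v'`. All terms of
`‖s' - τ‖²` have known limits, so `τ` stays close to `s'`, while `⟨s, τ⟩` converges by hypothesis.
-/
theorem SectionwiseTendsto.tendsto_inner (hopen : IsOpenMap fun a : Tot F => a.proj)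
    (hσ : Continuous fun p : TotalSpace (Unit × Unit) (F ×ᵇ F) =>
      inner ℝ (σ p.proj p.snd.1) (σ p.proj p.snd.2))
    (hd : ∀ x, Dense (Submodule.span ℝ (Set.range (σ x)) : Set (V x)))
    {ι : Type*} {l : Filter ι} {x : ι → X} {x₀ : X} {s s' : ∀ i, V (x i)} {v v' : V x₀}
    (h : SectionwiseTendsto σ l x s v) (h' : SectionwiseTendsto σ l x s' v') :
    Tendsto (fun i => inner ℝ (s i) (s' i)) l (𝓝 (inner ℝ v v')) := by
  refine Metric.tendsto_nhds.mpr fun ε hε => ?_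
  have hM : 0 < ‖v‖ + 1 := by positivity
  -- Eventually `‖s‖ < ‖v‖ + 1`, so each of the two replacements of a vector by its approximant
  -- costs at most `ε / 3`.
  set δ := ε / (3 * (‖v‖ + 1)) with hδ
  have hδ0 : 0 < δ := by positivity
  have hδM : (‖v‖ + 1) * δ = ε / 3 := by rw [hδ]; field_simp
  obtain ⟨T, c, hT⟩ := exists_norm_sub_sum_lt (hd x₀) v' hδ0
  obtain ⟨l', hl', hγ⟩ := exists_lift hopen h.tendsto_base (fun γ : T => (γ : F x₀))
  have hfst : Tendsto Sigma.fst l' l := hl'.le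
  set w := ∑ γ : T, c γ • σ x₀ γ
  let τ : ∀ p : Σ i, T → F (x i), V (x p.1) := fun p => ∑ γ : T, c γ • σ (x p.1) (p.2 γ)
  have h1 : Tendsto (fun p => inner ℝ (s p.1) (τ p)) l' (𝓝 (inner ℝ v w)) := by
    simp only [τ, w, inner_sum, real_inner_smul_right]
    exact tendsto_finsetSum _ fun j _ => (h.comp hfst (hγ j)).const_mul _
  have h2 : Tendsto (fun p => inner ℝ (s' p.1) (τ p)) l' (𝓝 (inner ℝ v' w)) := by
    simp only [τ, w, inner_sum, real_inner_smul_right]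
    exact tendsto_finsetSum _ fun j _ => (h'.comp hfst (hγ j)).const_mul _
  have h3 : Tendsto (fun p => ‖τ p‖) l' (𝓝 ‖w‖) :=
    (SectionwiseTendsto.sum hσ (h.tendsto_base.comp hfst) (fun γ : T => c γ) hγ).tendsto_norm
  have h4 : Tendsto (fun p => ‖s' p.1 - τ p‖ ^ 2) l' (𝓝 (‖v' - w‖ ^ 2)) := by
    simp only [@norm_sub_sq_real]
    exact ((((h'.tendsto_norm.comp hfst).pow 2).sub (h2.const_mul 2)).add (h3.pow 2))
  have h5 := h4.eventually (gt_mem_nhds (pow_lt_pow_left₀ hT (norm_nonneg _) two_ne_zero))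
  have h6 := Metric.tendsto_nhds.mp h1 (ε / 3) (by positivity)
  have h7 := (h.tendsto_norm.comp hfst).eventually (gt_mem_nhds (lt_add_one ‖v‖))
  rw [← hl', eventually_map]
  filter_upwards [h5, h6, h7] with p h8 h9 h10
  have h11 : ‖s' p.1 - τ p‖ < δ := lt_of_pow_lt_pow_left₀ 2 hδ0.le h8
  have e1 : |inner ℝ (s p.1) (s' p.1 - τ p)| ≤ ε / 3 := by
    refine (abs_real_inner_le_norm _ _).trans ?_
    rw [← hδM]
    exact mul_le_mul h10.le h11.le (norm_nonneg _) hM.le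
  have e2 : |inner ℝ v (v' - w)| < ε / 3 := by
    refine (abs_real_inner_le_norm _ _).trans_lt ?_
    rw [← hδM]
    exact mul_lt_mul'' (lt_add_one _) hT (norm_nonneg _) (norm_nonneg _)
  rw [Real.dist_eq] at h9 ⊢
  rw [inner_sub_right] at e1 e2
  rw [abs_le] at e1
  rw [abs_lt] at e2 h9 ⊢
  constructor <;> linarith [e1.1, e1.2, e2.1, e2.2, h9.1, h9.2]

theorem SectionwiseTendsto.add (hopen : IsOpenMap fun a : Tot F => a.proj)
    (hσ : Continuous fun p : TotalSpace (Unit × Unit) (F ×ᵇ F) =>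
      inner ℝ (σ p.proj p.snd.1) (σ p.proj p.snd.2))
    (hd : ∀ x, Dense (Submodule.span ℝ (Set.range (σ x)) : Set (V x)))
    {ι : Type*} {l : Filter ι} {x : ι → X} {x₀ : X} {s s' : ∀ i, V (x i)} {v v' : V x₀}
    (h : SectionwiseTendsto σ l x s v) (h' : SectionwiseTendsto σ l x s' v') :
    SectionwiseTendsto σ l x (fun i => s i + s' i) (v + v') where
  tendsto_base := h.tendsto_base
  tendsto_norm := by
    have h1 := (((h.tendsto_norm.pow 2).add ((h.tendsto_inner hopen hσ hd h').const_mul 2)).add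
      (h'.tendsto_norm.pow 2)).sqrt
    simpa only [← @norm_add_sq_real, Real.sqrt_sq (norm_nonneg _)] using h1
  tendsto_section γ := by
    simp only [inner_add_left]
    exact (h.tendsto_section γ).add (h'.tendsto_section γ)

theorem SectionwiseTendsto.smul {ι : Type*} {l : Filter ι} {x : ι → X} {x₀ : X}
    {s : ∀ i, V (x i)} {v : V x₀} (h : SectionwiseTendsto σ l x s v) (c : ℝ) :
    SectionwiseTendsto σ l x (fun i => c • s i) (c • v) where
  tendsto_base := h.tendsto_base
  tendsto_norm := by
    simp only [norm_smul]
    exact h.tendsto_norm.const_mul _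
  tendsto_section γ := by
    simp only [real_inner_smul_left]
    exact (h.tendsto_section γ).const_mul _

theorem SectionwiseTendsto.zero
    (hσ : Continuous fun p : TotalSpace (Unit × Unit) (F ×ᵇ F) =>
      inner ℝ (σ p.proj p.snd.1) (σ p.proj p.snd.2))
    {ι : Type*} {l : Filter ι} {x : ι → X} {x₀ : X} {s : ∀ i, V (x i)} (hx : Tendsto x l (𝓝 x₀))
    (hs : Tendsto (fun i => ‖s i‖) l (𝓝 0)) : SectionwiseTendsto σ l x s (0 : V x₀) where
  tendsto_base := hx
  tendsto_norm := by rwa [norm_zero]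
  tendsto_section γ := by
    have h1 := tendsto_snd_liftFilter l x γ
    have h2 := (hs.comp (tendsto_fst_liftFilter l x γ)).mul (tendsto_inner_sections hσ h1 h1).sqrt
    simp only [← norm_eq_sqrt_real_inner, zero_mul] at h2
    rw [inner_zero_left]
    exact squeeze_zero_norm (fun p => norm_inner_le_norm _ _) h2

theorem SectionwiseTendsto.fiber
    (hσ : Continuous fun p : TotalSpace (Unit × Unit) (F ×ᵇ F) =>
      inner ℝ (σ p.proj p.snd.1) (σ p.proj p.snd.2))
    {x : X} (v : V x) : SectionwiseTendsto σ (𝓝 v) (fun _ => x) (fun w => w) v where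
  tendsto_base := tendsto_const_nhds
  tendsto_norm := continuous_norm.continuousAt
  tendsto_section γ := by
    have h1 : Tendsto (fun p : Σ _ : V x, F x => σ x p.2) (liftFilter (𝓝 v) (fun _ => x) γ)
        (𝓝 (σ x γ)) := by
      refine Metric.tendsto_nhds.mpr fun ε hε => ?_
      obtain ⟨U, hU, h⟩ := exists_nhds_norm_sub_lt hσ γ hε
      filter_upwards [tendsto_snd_liftFilter (𝓝 v) (fun _ => x) γ hU] with p hp
      rw [dist_eq_norm]
      exact h x _ _ hp (mem_of_mem_nhds hU)
    exact (tendsto_fst_liftFilter (𝓝 v) (fun _ => x) γ).inner h1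

theorem isHilbertBundle_sectionTopology [T2Space X] [∀ x, CompleteSpace (V x)]
    (hopen : IsOpenMap fun a : Tot F => a.proj)
    (hσ : Continuous fun p : TotalSpace (Unit × Unit) (F ×ᵇ F) =>
      inner ℝ (σ p.proj p.snd.1) (σ p.proj p.snd.2))
    (hd : ∀ x, Dense (Submodule.span ℝ (Set.range (σ x)) : Set (V x)))
    [t : TopologicalSpace (Tot V)] (ht : t = sectionTopology σ) : IsHilbertBundle V := by
  have hle : ∀ {l : Filter (Tot V)} {a : Tot V}, l ≤ 𝓝 a ↔
      SectionwiseTendsto σ l (fun b => b.proj) (fun b => b.snd) a.snd :=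
    fun {l a} => tendsto_sectionTopology_iff hopen hσ ht (l := l) (x := fun b => b.proj)
      (s := fun b => b.snd) (v := a.snd)
  have hfib : ∀ x, Continuous fun v : V x => (⟨x, v⟩ : Tot V) := fun x =>
    continuous_iff_continuousAt.mpr fun v =>
      (tendsto_sectionTopology_iff hopen hσ ht).mpr (SectionwiseTendsto.fiber hσ v)
  refine ⟨?_, ?_, ?_, ?_, ?_, ?_, ?_⟩
  · refine t2_iff_nhds.mpr fun {a b} hab => ?_
    have ha := hle.mp (inf_le_left : 𝓝 a ⊓ 𝓝 b ≤ 𝓝 a)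
    have hb := hle.mp (inf_le_right : 𝓝 a ⊓ 𝓝 b ≤ 𝓝 b)
    obtain ⟨x, v⟩ := a
    obtain ⟨y, w⟩ := b
    obtain rfl : x = y := tendsto_nhds_unique ha.tendsto_base hb.tendsto_base
    -- Two limits `v`, `w` of one filter satisfy `⟨v, v⟩ = ⟨v, w⟩ = ⟨w, w⟩`, hence `‖v - w‖² = 0`.
    have h1 := tendsto_nhds_unique (ha.tendsto_inner hopen hσ hd ha)
      (ha.tendsto_inner hopen hσ hd hb)
    have h2 := tendsto_nhds_unique (hb.tendsto_inner hopen hσ hd hb)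
      (ha.tendsto_inner hopen hσ hd hb)
    have h3 : inner ℝ (v - w) (v - w) = 0 := by
      rw [real_inner_sub_sub_self]
      linarith
    rw [inner_self_eq_zero, sub_eq_zero] at h3
    rw [h3]
  · exact continuous_iff_continuousAt.mpr fun a => (hle.mp le_rfl).tendsto_base
  · refine isOpenMap_iff_nhds_le.mpr fun a S hS => ?_
    obtain ⟨O, hOS, hO, haO⟩ := mem_nhds_iff.mp (mem_map.mp hS)
    obtain ⟨ε, hε, hball⟩ := Metric.mem_nhds_iff.mp ((hfib a.proj).continuousAt.preimage_mem_nhds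
      (hO.mem_nhds haO) : _ ∈ 𝓝 a.snd)
    -- A finite combination of sections already lies in the open set, and it lifts to all nearby
    -- base points.
    obtain ⟨T, c, hT⟩ := exists_norm_sub_sum_lt (hd a.proj) a.snd hε
    obtain ⟨l', hl', hγ⟩ := exists_lift hopen (tendsto_id (x := 𝓝 a.proj))
      (fun γ : T => (γ : F a.proj))
    have hfst : Tendsto Sigma.fst l' (𝓝 a.proj) := hl'.le
    have h1 := (tendsto_sectionTopology_iff hopen hσ ht).mpr
      (SectionwiseTendsto.sum hσ hfst (fun γ : T => c γ) hγ)
    have h2 := h1.eventually (hO.mem_nhds (hball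
      (by rwa [Metric.mem_ball, dist_comm, dist_eq_norm])))
    rw [← hl', mem_map]
    filter_upwards [h2] with p hp using hOS hp
  · exact continuous_iff_continuousAt.mpr fun a => (hle.mp le_rfl).tendsto_norm
  · refine continuous_iff_continuousAt.mpr fun p => ?_
    have h := tendsto_fiberProduct_iff.mp (tendsto_id (x := 𝓝 p))
    exact (tendsto_sectionTopology_iff hopen hσ ht).mpr <| SectionwiseTendsto.add hopen hσ hd
      ((tendsto_sectionTopology_iff hopen hσ ht).mp h.1)
      ((tendsto_sectionTopology_iff hopen hσ ht).mp h.2)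
  · exact fun c => continuous_iff_continuousAt.mpr fun a =>
      (tendsto_sectionTopology_iff hopen hσ ht).mpr ((hle.mp le_rfl).smul c)
  · exact fun x l hl hn => hle.mpr (SectionwiseTendsto.zero hσ hl hn)

theorem continuous_of_sectionTopology (hopen : IsOpenMap fun a : Tot F => a.proj)
    (hbase : Continuous fun a : Tot F => a.proj)
    (hσ : Continuous fun p : TotalSpace (Unit × Unit) (F ×ᵇ F) =>
      inner ℝ (σ p.proj p.snd.1) (σ p.proj p.snd.2))
    [t : TopologicalSpace (Tot V)] (ht : t = sectionTopology σ) :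
    Continuous fun a : Tot F => (⟨a.proj, σ a.proj a.snd⟩ : Tot V) := by
  refine continuous_iff_continuousAt.mpr fun a => (tendsto_sectionTopology_iff hopen hσ ht).mpr ?_
  have := SectionwiseTendsto.sum hσ (hbase.tendsto a) (fun _ : Unit => (1 : ℝ))
    (γ := fun b _ => b.snd) (γ₀ := fun _ => a.snd) (fun _ => tendsto_id)
  simpa only [Finset.univ_unique, Finset.sum_singleton, one_smul] using this

end Sections

/-! ### Convergence in an arbitrary Hilbert bundle -/

namespace IsHilbertBundle

variable {X : Type u} [TopologicalSpace X] {V : X → Type w}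
    [∀ x, NormedAddCommGroup (V x)] [∀ x, InnerProductSpace ℝ (V x)] [∀ x, CompleteSpace (V x)]
    [TopologicalSpace (Tot V)] (hV : IsHilbertBundle V)
  {ι : Type*} {l : Filter ι} {x : ι → X} {x₀ : X} {s s' : ∀ i, V (x i)} {v v' : V x₀}

include hV

theorem tendsto_base (h : Tendsto (fun i => (⟨x i, s i⟩ : Tot V)) l (𝓝 ⟨x₀, v⟩)) :
    Tendsto x l (𝓝 x₀) :=
  (hV.continuous_proj.tendsto _).comp h

theorem tendsto_norm (h : Tendsto (fun i => (⟨x i, s i⟩ : Tot V)) l (𝓝 ⟨x₀, v⟩)) :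
    Tendsto (fun i => ‖s i‖) l (𝓝 ‖v‖) :=
  (hV.continuous_norm.tendsto _).comp h

theorem tendsto_add (h : Tendsto (fun i => (⟨x i, s i⟩ : Tot V)) l (𝓝 ⟨x₀, v⟩))
    (h' : Tendsto (fun i => (⟨x i, s' i⟩ : Tot V)) l (𝓝 ⟨x₀, v'⟩)) :
    Tendsto (fun i => (⟨x i, s i + s' i⟩ : Tot V)) l (𝓝 ⟨x₀, v + v'⟩) :=
  (hV.continuous_add.tendsto ⟨x₀, (v, v')⟩).comp
    (tendsto_fiberProduct_iff (p := fun i => ⟨x i, (s i, s' i)⟩).mpr ⟨h, h'⟩)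

theorem tendsto_smul (c : ℝ) (h : Tendsto (fun i => (⟨x i, s i⟩ : Tot V)) l (𝓝 ⟨x₀, v⟩)) :
    Tendsto (fun i => (⟨x i, c • s i⟩ : Tot V)) l (𝓝 ⟨x₀, c • v⟩) :=
  ((hV.continuous_smul c).tendsto ⟨x₀, v⟩).comp h

theorem tendsto_sub (h : Tendsto (fun i => (⟨x i, s i⟩ : Tot V)) l (𝓝 ⟨x₀, v⟩))
    (h' : Tendsto (fun i => (⟨x i, s' i⟩ : Tot V)) l (𝓝 ⟨x₀, v'⟩)) :
    Tendsto (fun i => (⟨x i, s i - s' i⟩ : Tot V)) l (𝓝 ⟨x₀, v - v'⟩) := by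
  have := hV.tendsto_add h (hV.tendsto_smul (-1) h')
  simpa only [neg_smul, one_smul, ← sub_eq_add_neg] using this

theorem tendsto_zero (hx : Tendsto x l (𝓝 x₀)) (hs : Tendsto (fun i => ‖s i‖) l (𝓝 0)) :
    Tendsto (fun i => (⟨x i, s i⟩ : Tot V)) l (𝓝 ⟨x₀, 0⟩) :=
  hV.le_nhds_zero x₀ _ (tendsto_map'_iff.mpr hx) (tendsto_map'_iff.mpr hs)

theorem tendsto_inner (h : Tendsto (fun i => (⟨x i, s i⟩ : Tot V)) l (𝓝 ⟨x₀, v⟩))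
    (h' : Tendsto (fun i => (⟨x i, s' i⟩ : Tot V)) l (𝓝 ⟨x₀, v'⟩)) :
    Tendsto (fun i => inner ℝ (s i) (s' i)) l (𝓝 (inner ℝ v v')) := by
  simp only [real_inner_eq_norm_add_mul_self_sub_norm_mul_self_sub_norm_mul_self_div_two]
  have h1 := hV.tendsto_norm (hV.tendsto_add h h')
  have h2 := hV.tendsto_norm h
  have h3 := hV.tendsto_norm h'
  exact (((h1.mul h1).sub (h2.mul h2)).sub (h3.mul h3)).div_const 2

theorem tendsto_sum {κ : Type*} (T : Finset κ) (hx : Tendsto x l (𝓝 x₀)) {t : ∀ i, κ → V (x i)}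
    {t₀ : κ → V x₀} (h : ∀ j, Tendsto (fun i => (⟨x i, t i j⟩ : Tot V)) l (𝓝 ⟨x₀, t₀ j⟩)) :
    Tendsto (fun i => (⟨x i, ∑ j ∈ T, t i j⟩ : Tot V)) l (𝓝 ⟨x₀, ∑ j ∈ T, t₀ j⟩) := by
  classical
  induction T using Finset.induction_on with
  | empty =>
    simp only [Finset.sum_empty]
    exact hV.tendsto_zero hx (by simpa only [norm_zero] using tendsto_const_nhds)
  | insert j T hj ih =>
    simp only [Finset.sum_insert hj]
    exact hV.tendsto_add (h j) ih

/-- In a Hilbert bundle with a total continuous family of sections, convergence is determined by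
the base points, the norms and the inner products with the family. -/
theorem tendsto_iff_sectionwise {F : X → Type*} [TopologicalSpace (Tot F)]
    (hopen : IsOpenMap fun a : Tot F => a.proj) {σ : ∀ x, F x → V x}
    (hσ : Continuous fun a : Tot F => (⟨a.proj, σ a.proj a.snd⟩ : Tot V))
    (hd : ∀ x, Dense (Submodule.span ℝ (Set.range (σ x)) : Set (V x))) :
    Tendsto (fun i => (⟨x i, s i⟩ : Tot V)) l (𝓝 ⟨x₀, v⟩) ↔ SectionwiseTendsto σ l x s v := by
  constructor
  · intro h
    exact ⟨hV.tendsto_base h, hV.tendsto_norm h, fun γ =>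
      hV.tendsto_inner (x := fun p : Σ i, F (x i) => x p.1)
        (h.comp (tendsto_fst_liftFilter l x γ))
        ((hσ.tendsto _).comp (tendsto_snd_liftFilter l x γ))⟩
  intro h
  -- Lift `v` itself to vectors `b` converging to it. Comparison with finite combinations of
  -- sections gives `‖s - b‖ → 0`, and then `s = (s - b) + b`.
  obtain ⟨l', hl', hb⟩ := exists_lift hV.isOpenMap_proj h.tendsto_base (fun _ : Unit => v)
  have hfst : Tendsto Sigma.fst l' l := hl'.le
  have hx' := h.tendsto_base.comp hfst
  let b : ∀ p : Σ i, Unit → V (x i), V (x p.1) := fun p => p.2 ()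
  have hsb : Tendsto (fun p => ‖s p.1 - b p‖) l' (𝓝 0) := by
    refine Metric.tendsto_nhds.mpr fun ε hε => ?_
    obtain ⟨T, c, hT⟩ := exists_norm_sub_sum_lt (hd x₀) v (half_pos hε)
    obtain ⟨l'', hl'', hγ⟩ := exists_lift hopen hx' (fun γ : T => (γ : F x₀))
    have hfst' : Tendsto Sigma.fst l'' l' := hl''.le
    set w := ∑ γ : T, c γ • σ x₀ γ
    let τ : ∀ q : Σ p : (Σ i, Unit → V (x i)), T → F (x p.1), V (x q.1.1) :=
      fun q => ∑ γ : T, c γ • σ (x q.1.1) (q.2 γ)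
    have hτ : Tendsto (fun q => (⟨x q.1.1, τ q⟩ : Tot V)) l'' (𝓝 ⟨x₀, w⟩) :=
      hV.tendsto_sum Finset.univ (hx'.comp hfst') fun γ : T =>
        hV.tendsto_smul (c γ) ((hσ.tendsto _).comp (hγ γ))
    have h1 : Tendsto (fun q => ‖τ q - b q.1‖) l'' (𝓝 ‖w - v‖) :=
      hV.tendsto_norm (hV.tendsto_sub hτ ((hb ()).comp hfst'))
    have h2 : Tendsto (fun q => inner ℝ (s q.1.1) (τ q)) l'' (𝓝 (inner ℝ v w)) := by
      simp only [τ, w, inner_sum, real_inner_smul_right]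
      exact tendsto_finsetSum _ fun j _ => (h.comp (hfst.comp hfst') (hγ j)).const_mul _
    have h3 : Tendsto (fun q => ‖s q.1.1 - τ q‖ ^ 2) l'' (𝓝 (‖v - w‖ ^ 2)) := by
      simp only [@norm_sub_sq_real]
      exact ((((h.tendsto_norm.comp (hfst.comp hfst')).pow 2).sub (h2.const_mul 2)).add
        ((hV.tendsto_norm hτ).pow 2))
    have h4 := h3.eventually (gt_mem_nhds (pow_lt_pow_left₀ hT (norm_nonneg _) two_ne_zero))
    have h5 := h1.eventually (gt_mem_nhds (show ‖w - v‖ < ε / 2 by rwa [norm_sub_rev]))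
    rw [← hl'', eventually_map]
    filter_upwards [h4, h5] with q h6 h7
    have h8 : ‖s q.1.1 - τ q‖ < ε / 2 := lt_of_pow_lt_pow_left₀ 2 (half_pos hε).le h6
    have h9 : ‖τ q - b q.1‖ < ε / 2 := h7
    rw [dist_zero_right, norm_norm]
    have := norm_sub_le_norm_sub_add_norm_sub (s q.1.1) (τ q) (b q.1)
    linarith
  rw [← hl', tendsto_map'_iff]
  have := hV.tendsto_add (hV.tendsto_zero hx' hsb) (hb ())
  simpa only [b, sub_add_cancel, zero_add, Function.comp_def] using this

end IsHilbertBundle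

/-! ### Affine Hilbert bundles and their isometries -/

namespace IsAffineHilbertBundle

variable {X : Type u} [TopologicalSpace X] {V : X → Type w}
    [∀ x, NormedAddCommGroup (V x)] [∀ x, InnerProductSpace ℝ (V x)] [∀ x, CompleteSpace (V x)]
    [TopologicalSpace (Tot V)] {E : X → Type w} [∀ x, MetricSpace (E x)]
    [∀ x, NormedAddTorsor (V x) (E x)] [TopologicalSpace (Tot E)]

theorem tendsto_vadd (hE : IsAffineHilbertBundle V E) {ι : Type*} {l : Filter ι} {x : ι → X}
    {x₀ : X} {a : ∀ i, V (x i)} {a₀ : V x₀} {p : ∀ i, E (x i)} {p₀ : E x₀}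
    (ha : Tendsto (fun i => (⟨x i, a i⟩ : Tot V)) l (𝓝 ⟨x₀, a₀⟩))
    (hp : Tendsto (fun i => (⟨x i, p i⟩ : Tot E)) l (𝓝 ⟨x₀, p₀⟩)) :
    Tendsto (fun i => (⟨x i, a i +ᵥ p i⟩ : Tot E)) l (𝓝 ⟨x₀, a₀ +ᵥ p₀⟩) :=
  (tendsto_fiberProduct_iff.mp ((hE.isHomeomorph_vadd.continuous.tendsto ⟨x₀, (p₀, a₀)⟩).comp
    (tendsto_fiberProduct_iff (p := fun i => ⟨x i, (p i, a i)⟩).mpr ⟨hp, ha⟩))).2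

/-- Continuity of differences is the continuity of the inverse of `(p, a) ↦ (p, a +ᵥ p)`. -/
theorem tendsto_vsub (hE : IsAffineHilbertBundle V E) {ι : Type*} {l : Filter ι} {x : ι → X}
    {x₀ : X} {p q : ∀ i, E (x i)} {p₀ q₀ : E x₀}
    (hp : Tendsto (fun i => (⟨x i, p i⟩ : Tot E)) l (𝓝 ⟨x₀, p₀⟩))
    (hq : Tendsto (fun i => (⟨x i, q i⟩ : Tot E)) l (𝓝 ⟨x₀, q₀⟩)) :
    Tendsto (fun i => (⟨x i, p i -ᵥ q i⟩ : Tot V)) l (𝓝 ⟨x₀, p₀ -ᵥ q₀⟩) := by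
  refine (tendsto_fiberProduct_iff (E := E) (p := fun i => ⟨x i, (q i, p i -ᵥ q i)⟩)
    (q := ⟨x₀, (q₀, p₀ -ᵥ q₀)⟩).mp ?_).2
  rw [hE.isHomeomorph_vadd.isInducing.tendsto_nhds_iff, tendsto_fiberProduct_iff]
  simpa only [Function.comp_def, vsub_vadd] using ⟨hq, hp⟩

/-- The bundle structure of an affine Hilbert bundle with fibres `V x` acting on themselves. -/
theorem of_isHilbertBundle (hV : IsHilbertBundle V) : IsAffineHilbertBundle V V where
  direction := hV
  t2 := hV.t2
  continuous_proj := hV.continuous_proj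
  isOpenMap_proj := hV.isOpenMap_proj
  isHomeomorph_vadd := by
    have hf : Continuous (fun p : TotalSpace (Unit × Unit) (V ×ᵇ V) =>
        (⟨p.proj, (p.snd.1, p.snd.2 +ᵥ p.snd.1)⟩ : TotalSpace (Unit × Unit) (V ×ᵇ V))) :=
      continuous_iff_continuousAt.mpr fun p => by
        have h := tendsto_fiberProduct_iff.mp (tendsto_id (x := 𝓝 p))
        exact tendsto_fiberProduct_iff.mpr ⟨h.1, hV.tendsto_add h.2 h.1⟩
    have hg : Continuous (fun p : TotalSpace (Unit × Unit) (V ×ᵇ V) =>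
        (⟨p.proj, (p.snd.1, p.snd.2 - p.snd.1)⟩ : TotalSpace (Unit × Unit) (V ×ᵇ V))) :=
      continuous_iff_continuousAt.mpr fun p => by
        have h := tendsto_fiberProduct_iff.mp (tendsto_id (x := 𝓝 p))
        exact tendsto_fiberProduct_iff.mpr ⟨h.1, hV.tendsto_sub h.2 h.1⟩
    refine isHomeomorph_iff_exists_inverse.mpr ⟨hf, _, ?_, ?_, hg⟩
    · rintro ⟨x, a, b⟩
      simp
    · rintro ⟨x, a, b⟩
      simp

variable {V' : X → Type w₁}
    [∀ x, NormedAddCommGroup (V' x)] [∀ x, InnerProductSpace ℝ (V' x)] [∀ x, CompleteSpace (V' x)]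
    [TopologicalSpace (Tot V')] {E' : X → Type w₁} [∀ x, MetricSpace (E' x)]
    [∀ x, NormedAddTorsor (V' x) (E' x)] [TopologicalSpace (Tot E')]
    {F : X → Type*} [TopologicalSpace (Tot F)]

/-- Fibrewise isometries of affine Hilbert bundles that intertwine total continuous families are
continuous, and so are their linear parts. -/
theorem continuous_of_intertwining (hE : IsAffineHilbertBundle V E)
    (hE' : IsAffineHilbertBundle V' E') (hopen : IsOpenMap fun a : Tot F => a.proj)
    {e : ∀ x, F x} (he : Continuous fun x => (⟨x, e x⟩ : Tot F))
    {p : ∀ x, F x → E x} (hp : Continuous fun a : Tot F => (⟨a.proj, p a.proj a.snd⟩ : Tot E))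
    (hd : ∀ x, Dense (affineSpan ℝ (Set.range (p x)) : Set (E x)))
    {p' : ∀ x, F x → E' x} (hp' : Continuous fun a : Tot F => (⟨a.proj, p' a.proj a.snd⟩ : Tot E'))
    (hd' : ∀ x, Dense (affineSpan ℝ (Set.range (p' x)) : Set (E' x)))
    (hbase : Continuous fun a : Tot F => a.proj)
    (φ : ∀ x, E x ≃ᵃⁱ[ℝ] E' x) (hφ : ∀ x γ, φ x (p x γ) = p' x γ) :
    (Continuous fun a : Tot E => (⟨a.proj, φ a.proj a.snd⟩ : Tot E')) ∧
      Continuous fun a : Tot V =>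
        (⟨a.proj, (φ a.proj).linearIsometryEquiv a.snd⟩ : Tot V') := by
  have hpe : ∀ a : Tot F, Tendsto (fun b : Tot F => (⟨b.proj, p b.proj (e b.proj)⟩ : Tot E)) (𝓝 a)
      (𝓝 ⟨a.proj, p a.proj (e a.proj)⟩) := fun a =>
    (hp.comp (he.comp hbase)).tendsto a
  have hpe' : ∀ a : Tot F, Tendsto (fun b : Tot F => (⟨b.proj, p' b.proj (e b.proj)⟩ : Tot E'))
      (𝓝 a) (𝓝 ⟨a.proj, p' a.proj (e a.proj)⟩) := fun a =>
    (hp'.comp (he.comp hbase)).tendsto a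
  have hσ : Continuous fun a : Tot F =>
      (⟨a.proj, p a.proj a.snd -ᵥ p a.proj (e a.proj)⟩ : Tot V) :=
    continuous_iff_continuousAt.mpr fun a => hE.tendsto_vsub (hp.tendsto a) (hpe a)
  have hσ' : Continuous fun a : Tot F =>
      (⟨a.proj, p' a.proj a.snd -ᵥ p' a.proj (e a.proj)⟩ : Tot V') :=
    continuous_iff_continuousAt.mpr fun a => hE'.tendsto_vsub (hp'.tendsto a) (hpe' a)
  have hlin : Continuous fun a : Tot V =>
      (⟨a.proj, (φ a.proj).linearIsometryEquiv a.snd⟩ : Tot V') := by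
    refine continuous_iff_continuousAt.mpr fun a => ?_
    -- Differences with the base section form total families in both direction bundles, exchanged by
    -- the linear parts; norms and inner products, hence convergence, carry over.
    have h := (hE.direction.tendsto_iff_sectionwise hopen
      (σ := fun x γ => p x γ -ᵥ p x (e x)) hσ
      (fun x => (dense_affineSpan_range_iff (p x) (e x)).mp (hd x))).mp (tendsto_id (x := 𝓝 a))
    refine (hE'.direction.tendsto_iff_sectionwise hopen
      (σ := fun x γ => p' x γ -ᵥ p' x (e x)) hσ'
      (fun x => (dense_affineSpan_range_iff (p' x) (e x)).mp (hd' x))).mpr ⟨h.tendsto_base, ?_, ?_⟩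
    · simpa only [LinearIsometryEquiv.norm_map] using h.tendsto_norm
    · intro γ
      simpa only [← hφ, ← AffineIsometryEquiv.map_vsub, LinearIsometryEquiv.inner_map_map]
        using h.tendsto_section γ
  refine ⟨continuous_iff_continuousAt.mpr fun a => ?_, hlin⟩
  have hb : Tendsto (fun b : Tot E => b.proj) (𝓝 a) (𝓝 a.proj) := hE.continuous_proj.tendsto a
  have h1 : Tendsto (fun b : Tot E => (⟨b.proj, b.snd -ᵥ p b.proj (e b.proj)⟩ : Tot V)) (𝓝 a)
      (𝓝 ⟨a.proj, a.snd -ᵥ p a.proj (e a.proj)⟩) :=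
    hE.tendsto_vsub tendsto_id (((hp.comp he).tendsto a.proj).comp hb)
  have h2 := hE'.tendsto_vadd ((hlin.tendsto _).comp h1) (((hp'.comp he).tendsto a.proj).comp hb)
  simpa only [ContinuousAt, Function.comp_def, ← hφ, AffineIsometryEquiv.map_vsub, vsub_vadd]
    using h2

theorem isHomeomorph_of_intertwining (hE : IsAffineHilbertBundle V E)
    (hE' : IsAffineHilbertBundle V' E') (hopen : IsOpenMap fun a : Tot F => a.proj)
    {e : ∀ x, F x} (he : Continuous fun x => (⟨x, e x⟩ : Tot F))
    {p : ∀ x, F x → E x} (hp : Continuous fun a : Tot F => (⟨a.proj, p a.proj a.snd⟩ : Tot E))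
    (hd : ∀ x, Dense (affineSpan ℝ (Set.range (p x)) : Set (E x)))
    {p' : ∀ x, F x → E' x} (hp' : Continuous fun a : Tot F => (⟨a.proj, p' a.proj a.snd⟩ : Tot E'))
    (hd' : ∀ x, Dense (affineSpan ℝ (Set.range (p' x)) : Set (E' x)))
    (hbase : Continuous fun a : Tot F => a.proj)
    (φ : ∀ x, E x ≃ᵃⁱ[ℝ] E' x) (hφ : ∀ x γ, φ x (p x γ) = p' x γ) :
    (IsHomeomorph fun a : Tot E => (⟨a.proj, φ a.proj a.snd⟩ : Tot E')) ∧
      IsHomeomorph fun a : Tot V =>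
        (⟨a.proj, (φ a.proj).linearIsometryEquiv a.snd⟩ : Tot V') := by
  obtain ⟨h1, h2⟩ := continuous_of_intertwining hE hE' hopen he hp hd hp' hd' hbase φ hφ
  obtain ⟨h3, h4⟩ := continuous_of_intertwining hE' hE hopen he hp' hd' hp hd hbase
    (fun x => (φ x).symm) (fun x γ => by rw [← hφ, AffineIsometryEquiv.symm_apply_apply])
  refine ⟨isHomeomorph_iff_exists_inverse.mpr ⟨h1, _, fun a => ?_, fun a => ?_, h3⟩,
    isHomeomorph_iff_exists_inverse.mpr ⟨h2, _, fun a => ?_, fun a => ?_, h4⟩⟩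
  · simp
  · simp
  · obtain ⟨x, a⟩ := a
    exact congrArg (TotalSpace.mk x) ((φ x).linearIsometryEquiv.symm_apply_apply a)
  · obtain ⟨x, a⟩ := a
    exact congrArg (TotalSpace.mk x) ((φ x).linearIsometryEquiv.apply_symm_apply a)

end IsAffineHilbertBundle

/-! ### The bundle of range fibres of a topological groupoid -/

namespace RFib

variable {X : Type u} [Groupoid.{v} X]

/-- The unit at `x` as an element of the range fibre. -/
def unit (x : X) : RFib x := ⟨x, 𝟙 x⟩

theorem invMul_self {x : X} (γ : RFib x) : invMul γ γ = Arr.unit γ.src := by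
  simp [invMul, Arr.unit, Groupoid.inv_eq_inv]

theorem invMul_symm {x : X} (γ γ' : RFib x) : invMul γ' γ = (invMul γ γ').inv := by
  simp [invMul, Arr.inv, Groupoid.inv_eq_inv]

theorem invMul_unit_left {x : X} (γ : RFib x) : invMul (unit x) γ = γ.toArr := by
  simp [invMul, unit, toArr, Groupoid.inv_eq_inv]

theorem invMul_unit_right {x : X} (γ : RFib x) : invMul γ (unit x) = γ.toArr.inv := by
  simp [invMul, unit, toArr, Arr.inv]

/-- The invariance that makes left translations isometric for the kernel of `ψ`. -/
theorem invMul_lmul {x y : X} (γ : x ⟶ y) (γ₁ γ₂ : RFib x) :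
    invMul (lmul γ γ₁) (lmul γ γ₂) = invMul γ₁ γ₂ := by
  simp [invMul, lmul, Groupoid.inv_eq_inv]

theorem lmul_lmul {x y z : X} (γ' : x ⟶ y) (γ : y ⟶ z) (γ₁ : RFib x) :
    lmul γ (lmul γ' γ₁) = lmul (γ' ≫ γ) γ₁ := by
  simp [lmul]

theorem lmul_id {x : X} (γ₁ : RFib x) : lmul (𝟙 x) γ₁ = γ₁ := by
  simp [lmul]

theorem lmul_inv_lmul {x y : X} (γ : x ⟶ y) (γ₁ : RFib y) :
    lmul γ (lmul (Groupoid.inv γ) γ₁) = γ₁ := by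
  rw [lmul_lmul, Groupoid.inv_comp, lmul_id]

theorem lmul_surjective {x y : X} (γ : x ⟶ y) : Function.Surjective (lmul γ) :=
  fun γ₁ => ⟨_, lmul_inv_lmul γ γ₁⟩

theorem toArr_injective {x : X} : Function.Injective (toArr : RFib x → Arr X) := by
  rintro ⟨a, f⟩ ⟨b, g⟩ h
  simp only [toArr, Arr.mk.injEq, true_and] at h
  obtain ⟨rfl, h⟩ := h
  rw [eq_of_heq h]

theorem invMul_eq_mul {x : X} (γ γ' : RFib x) :
    invMul γ γ' = Arr.mul γ.toArr.inv γ'.toArr rfl := by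
  simp [invMul, Arr.mul, toArr, Arr.inv]

theorem toArr_lmul_inv (γ : Arr X) (γ₁ : RFib γ.rng) :
    (lmul (Groupoid.inv γ.hom) γ₁).toArr = Arr.mul γ.inv γ₁.toArr rfl := by
  simp [lmul, Arr.mul, toArr, Arr.inv]

variable [TopologicalSpace (Arr X)]

/-- The bundle of range fibres has the topology of the arrow space. -/
instance : TopologicalSpace (Tot (RFib : X → Type _)) :=
  TopologicalSpace.induced (fun a => a.snd.toArr) inferInstance

theorem isInducing_toArr : IsInducing fun a : Tot (RFib : X → Type _) => a.snd.toArr := ⟨rfl⟩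

theorem tendsto_iff {ι : Type*} {l : Filter ι} {γ : ι → Tot (RFib : X → Type _)}
    {γ₀ : Tot (RFib : X → Type _)} :
    Tendsto γ l (𝓝 γ₀) ↔ Tendsto (fun i => (γ i).snd.toArr) l (𝓝 γ₀.snd.toArr) :=
  isInducing_toArr.tendsto_nhds_iff

theorem continuous_toArr {x : X} : Continuous (toArr : RFib x → Arr X) :=
  continuous_induced_dom

theorem isEmbedding_toArr {x : X} : IsEmbedding (toArr : RFib x → Arr X) :=
  ⟨⟨rfl⟩, toArr_injective⟩

variable [TopologicalSpace X] [IsTopologicalGroupoid X]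

theorem tendsto_mul {ι : Type*} {l : Filter ι} {a b : ι → Arr X} {a₀ b₀ : Arr X}
    (h : ∀ i, (a i).src = (b i).rng) (h₀ : a₀.src = b₀.rng) (ha : Tendsto a l (𝓝 a₀))
    (hb : Tendsto b l (𝓝 b₀)) :
    Tendsto (fun i => Arr.mul (a i) (b i) (h i)) l (𝓝 (Arr.mul a₀ b₀ h₀)) :=
  ((IsTopologicalGroupoid.continuous_mul (X := X)).tendsto ⟨(a₀, b₀), h₀⟩).comp
    (f := fun i => ⟨(a i, b i), h i⟩) (tendsto_subtype_rng.mpr (ha.prodMk_nhds hb))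

theorem tendsto_inv {ι : Type*} {l : Filter ι} {a : ι → Arr X} {a₀ : Arr X}
    (ha : Tendsto a l (𝓝 a₀)) : Tendsto (fun i => (a i).inv) l (𝓝 a₀.inv) :=
  ((IsTopologicalGroupoid.continuous_inv (X := X)).tendsto a₀).comp ha

theorem continuous_invMul_tot :
    Continuous fun p : TotalSpace (Unit × Unit) ((RFib : X → Type _) ×ᵇ RFib) =>
      invMul p.snd.1 p.snd.2 := by
  refine continuous_iff_continuousAt.mpr fun p => ?_
  have h := tendsto_fiberProduct_iff.mp (tendsto_id (x := 𝓝 p))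
  simp only [ContinuousAt, invMul_eq_mul]
  exact tendsto_mul (fun _ => rfl) rfl (tendsto_inv (tendsto_iff.mp h.1)) (tendsto_iff.mp h.2)

theorem continuous_invMul {x : X} :
    Continuous fun p : RFib x × RFib x => invMul p.1 p.2 := by
  refine continuous_iff_continuousAt.mpr fun p => ?_
  simp only [ContinuousAt, invMul_eq_mul]
  exact tendsto_mul (fun _ => rfl) rfl
    (tendsto_inv ((continuous_toArr.comp continuous_fst).tendsto p))
    ((continuous_toArr.comp continuous_snd).tendsto p)

theorem continuous_proj : Continuous fun a : Tot (RFib : X → Type _) => a.proj :=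
  (IsTopologicalGroupoid.continuous_rng (X := X)).comp isInducing_toArr.continuous

theorem continuous_unit : Continuous fun x : X => (⟨x, unit x⟩ : Tot RFib) :=
  isInducing_toArr.continuous_iff.mpr (IsTopologicalGroupoid.continuous_unit (X := X))

end RFib

/-! ### Haar systems and openness of the range map -/

section Haar

theorem exists_continuous_bump {Y : Type*} [TopologicalSpace Y] [T2Space Y]
    [LocallyCompactSpace Y] (γ : Y) {U : Set Y} (hU : U ∈ 𝓝 γ) :
    ∃ f : Y → ℝ, Continuous f ∧ HasCompactSupport f ∧ (∀ γ', 0 ≤ f γ') ∧ f γ = 1 ∧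
      ∀ γ', f γ' ≠ 0 → γ' ∈ U := by
  obtain ⟨O, hOU, hO, hγ⟩ := mem_nhds_iff.mp hU
  obtain ⟨f, h1, h2, h3, h4⟩ := exists_continuous_one_zero_of_isCompact
    (isCompact_singleton (x := γ)) hO.isClosed_compl
    (Set.disjoint_compl_right_iff_subset.mpr (Set.singleton_subset_iff.mpr hγ))
  refine ⟨f, f.continuous, h3, fun γ' => (h4 γ').1, h1 rfl, fun γ' h => hOU ?_⟩
  by_contra hn
  exact h (h2 hn)

theorem HaarSystem.integrable {X : Type u} [Groupoid.{v} X] [TopologicalSpace X]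
    [TopologicalSpace (Arr X)] (lam : HaarSystem X) {H : Type*} [NormedAddCommGroup H] {x : X}
    {g : RFib x → H}
    (hg : Continuous g) (hg' : HasCompactSupport g) : Integrable g (lam.meas x) :=
  have := lam.finite_on_compacts x
  hg.integrable_of_hasCompactSupport hg'

variable {X : Type u} [Groupoid.{v} X] [TopologicalSpace X] [TopologicalSpace (Arr X)]
    [IsTopologicalGroupoid X] [T2Space (Arr X)]

variable (X) in
theorem IsTopologicalGroupoid.t2Space_units : T2Space X :=
  T2Space.of_injective_continuous (f := (Arr.unit : X → Arr X))
    (fun _ _ h => congrArg Arr.src h) IsTopologicalGroupoid.continuous_unit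

theorem RFib.isClosedEmbedding_toArr {x : X} : IsClosedEmbedding (toArr : RFib x → Arr X) := by
  have := IsTopologicalGroupoid.t2Space_units X
  refine ⟨isEmbedding_toArr, ?_⟩
  have : Set.range (toArr : RFib x → Arr X) = Arr.rng ⁻¹' {x} := by
    ext ⟨a, b, f⟩
    constructor
    · rintro ⟨γ, h⟩
      rw [← h]
      rfl
    · rintro rfl
      exact ⟨⟨a, f⟩, rfl⟩
  rw [this]
  exact isClosed_singleton.preimage IsTopologicalGroupoid.continuous_rng

theorem HasCompactSupport.comp_toArr {f : Arr X → ℝ} (hf : HasCompactSupport f) (x : X) :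
    HasCompactSupport fun γ : RFib x => f γ.toArr :=
  hf.comp_isClosedEmbedding RFib.isClosedEmbedding_toArr

namespace HaarSystem

variable (lam : HaarSystem X)

theorem integral_pos {f : Arr X → ℝ} (hf : Continuous f) (hc : HasCompactSupport f)
    (h0 : ∀ γ, 0 ≤ f γ) {x : X} {γ : RFib x} (hγ : f γ.toArr = 1) :
    0 < ∫ γ, f (RFib.toArr γ) ∂(lam.meas x) := by
  have := lam.finite_on_compacts x
  have := lam.full_support x
  exact (hf.comp RFib.continuous_toArr).integral_pos_of_hasCompactSupport_nonneg_nonzero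
    (hc.comp_toArr x) (fun γ => h0 _) (x := γ) (by simp [hγ])

variable [LocallyCompactSpace (Arr X)]

include lam in
/-- The range map of a locally compact groupoid with a Haar system is open. -/
theorem isOpenMap_rng : IsOpenMap (Arr.rng : Arr X → X) := by
  refine isOpenMap_iff_nhds_le.mpr fun γ S hS => ?_
  obtain ⟨f, hf, hc, h0, h1, hU⟩ := exists_continuous_bump γ (mem_map.mp hS)
  have hpos : 0 < ∫ γ', f (RFib.toArr γ') ∂(lam.meas γ.rng) :=
    lam.integral_pos hf hc h0 (γ := ⟨γ.src, γ.hom⟩) h1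
  -- The integral of the bump stays positive over nearby units, so their range fibres meet its
  -- support.
  filter_upwards [(lam.continuous_integral f hf hc).continuousAt.eventually (lt_mem_nhds hpos)]
    with x hx
  obtain ⟨γ', hγ'⟩ : ∃ γ' : RFib x, f γ'.toArr ≠ 0 := by
    by_contra! hn
    simp [hn] at hx
  exact hU _ hγ'

include lam in
theorem isOpenMap_proj : IsOpenMap fun a : Tot (RFib : X → Type _) => a.proj := by
  refine lam.isOpenMap_rng.comp (RFib.isInducing_toArr.isOpenMap ?_)
  have : Set.range (fun a : Tot (RFib : X → Type _) => a.snd.toArr) = Set.univ :=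
    Set.eq_univ_of_forall fun γ => ⟨⟨γ.rng, ⟨γ.src, γ.hom⟩⟩, rfl⟩
  rw [this]
  exact isOpen_univ

end HaarSystem

end Haar

/-! ### Functions represented by sections of affine Hilbert bundles -/

namespace GAffineHilbertBundle

variable {X : Type u} [Groupoid.{v} X] [TopologicalSpace X] [TopologicalSpace (Arr X)]

/-- Write `γ' = γ(γ⁻¹γ')` and cancel the isometry `A(γ)`. -/
theorem Represents.eq_invMul {E : GAffineHilbertBundle.{u, v, w} X} {e : ∀ x, E.fib x}
    {ψ : Arr X → ℝ} (h : E.Represents e ψ) {x : X} (γ γ' : RFib x) :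
    ψ (RFib.invMul γ γ') = ‖E.A γ.hom (e γ.src) -ᵥ E.A γ'.hom (e γ'.src)‖ ^ 2 := by
  have h1 : E.A γ'.hom (e γ'.src) = E.A γ.hom (E.A (γ'.hom ≫ Groupoid.inv γ.hom) (e γ'.src)) := by
    rw [← E.A_mul, Category.assoc, Groupoid.inv_comp, Category.comp_id]
  rw [h, h1, ← AffineIsometryEquiv.map_vsub, LinearIsometryEquiv.norm_map]
  rfl

theorem Represents.isCNT {E : GAffineHilbertBundle.{u, v, w} X} {e : ∀ x, E.fib x}
    {ψ : Arr X → ℝ} (h : E.Represents e ψ) : IsCNT ψ := by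
  intro x
  simp only [h.eq_invMul]
  exact isCNTKernel_norm_vsub_sq fun γ : RFib x => E.A γ.hom (e γ.src)

theorem IsContinuousSection.continuous_orbit {E : GAffineHilbertBundle.{u, v, w} X}
    {e : ∀ x, E.fib x} [IsTopologicalGroupoid X] (he : E.IsContinuousSection e) :
    Continuous fun a : Tot (RFib : X → Type _) =>
      (⟨a.proj, E.A a.snd.hom (e a.snd.src)⟩ : Tot E.fib) := by
  have h1 : Continuous fun a : Tot (RFib : X → Type _) =>
      (⟨a.snd.toArr, e a.snd.src⟩ : Tot (Arr.src *ᵖ E.fib)) := by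
    rw [(inducing_pullbackTotalSpaceEmbedding (F := Unit) (E := E.fib) Arr.src).continuous_iff]
    exact RFib.isInducing_toArr.continuous.prodMk (he.comp
      (IsTopologicalGroupoid.continuous_src.comp RFib.isInducing_toArr.continuous))
  exact E.continuous_A.comp h1

/-- Two generating continuous sections representing the same function are related by a unique
isomorphism. -/
theorem existsUnique_iso [IsTopologicalGroupoid X]
    (hopen : IsOpenMap fun a : Tot (RFib : X → Type _) => a.proj) {ψ : Arr X → ℝ}
    {E : GAffineHilbertBundle.{u, v, w₁} X} {e : ∀ x, E.fib x}
    {E' : GAffineHilbertBundle.{u, v, w₂} X} {e' : ∀ x, E'.fib x}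
    (hc : E.IsContinuousSection e) (hr : E.Represents e ψ) (hg : E.IsGenerating e)
    (hc' : E'.IsContinuousSection e') (hr' : E'.Represents e' ψ) (hg' : E'.IsGenerating e') :
    ∃! φ : Iso E E', ∀ x, φ.map x (e x) = e' x := by
  have hex : ∀ x, ∃ φ : E.fib x ≃ᵃⁱ[ℝ] E'.fib x, ∀ γ : RFib x,
      φ (E.A γ.hom (e γ.src)) = E'.A γ.hom (e' γ.src) := by
    intro x
    have : Nonempty (RFib x) := ⟨RFib.unit x⟩
    refine exists_affineIsometryEquiv_of_dist_eq _ _ (fun γ γ' => ?_) (hg x) (hg' x)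
    rw [← sq_eq_sq₀ dist_nonneg dist_nonneg, dist_eq_norm_vsub (E.dir x),
      dist_eq_norm_vsub (E'.dir x), ← hr.eq_invMul, ← hr'.eq_invMul]
  choose φ hφ using hex
  obtain ⟨h1, h2⟩ := IsAffineHilbertBundle.isHomeomorph_of_intertwining E.isAffineHilbertBundle
    E'.isAffineHilbertBundle hopen RFib.continuous_unit hc.continuous_orbit hg hc'.continuous_orbit
    hg' RFib.continuous_proj φ hφ
  refine ⟨⟨φ, h1, h2, fun {x y} γ p => ?_⟩, fun x => ?_, fun φ' hφ' => ?_⟩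
  -- Both sides are affine isometries agreeing on the generating orbit of `e`.
  · have : (E.A γ).trans (φ y) = (φ x).trans (E'.A γ) := by
      refine AffineIsometryEquiv.ext_of_dense (hg x) fun γ' => ?_
      have h3 : φ y (E.A (γ'.hom ≫ γ) (e γ'.src)) = E'.A (γ'.hom ≫ γ) (e' γ'.src) :=
        hφ y (RFib.lmul γ γ')
      rw [E.A_mul, E'.A_mul] at h3
      simp only [AffineIsometryEquiv.coe_trans, Function.comp_apply, hφ, h3]
    exact congrArg (fun f => f p) this
  · have h3 : φ x (E.A (𝟙 x) (e x)) = E'.A (𝟙 x) (e' x) := hφ x (RFib.unit x)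
    rwa [E.A_id, E'.A_id] at h3
  · have h4 : φ'.map = φ := by
      funext x
      refine AffineIsometryEquiv.ext_of_dense (hg x) fun γ => ?_
      rw [φ'.equivariant, hφ', hφ]
    obtain ⟨m, _, _, _⟩ := φ'
    simp only at h4
    subst h4
    rfl

end GAffineHilbertBundle

/-! ### The bundle constructed from a function conditionally of negative type -/

section Construction

variable {X : Type u} [Groupoid.{v} X] {H : X → Type w} [∀ x, NormedAddCommGroup (H x)]
  {σ : ∀ x, RFib x → H x} {ψ : Arr X → ℝ}

theorem norm_sq_of_kernel (h₀ : ∀ x, σ x (RFib.unit x) = 0)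
    (hk : ∀ x (γ γ' : RFib x), ‖σ x γ - σ x γ'‖ ^ 2 = ψ (RFib.invMul γ γ')) {x : X} (γ : RFib x) :
    ‖σ x γ‖ ^ 2 = ψ γ.toArr := by
  have := hk x (RFib.unit x) γ
  rwa [h₀, zero_sub, norm_neg, RFib.invMul_unit_left] at this

variable [∀ x, InnerProductSpace ℝ (H x)]

theorem inner_of_kernel (h₀ : ∀ x, σ x (RFib.unit x) = 0)
    (hk : ∀ x (γ γ' : RFib x), ‖σ x γ - σ x γ'‖ ^ 2 = ψ (RFib.invMul γ γ')) {x : X}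
    (γ γ' : RFib x) :
    inner ℝ (σ x γ) (σ x γ') = (ψ γ.toArr + ψ γ'.toArr - ψ (RFib.invMul γ γ')) / 2 := by
  rw [← hk, ← norm_sq_of_kernel h₀ hk, ← norm_sq_of_kernel h₀ hk, @norm_sub_sq_real]
  ring

theorem dense_affineSpan_of_kernel (h₀ : ∀ x, σ x (RFib.unit x) = 0)
    (hd : ∀ x, Dense (Submodule.span ℝ (Set.range (σ x)) : Set (H x))) (x : X) :
    Dense (affineSpan ℝ (Set.range (σ x)) : Set (H x)) := by
  rw [dense_affineSpan_range_iff (σ x) (RFib.unit x)]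
  simpa only [h₀, vsub_eq_sub, sub_zero] using hd x

/-- Left translation induces affine isometries. -/
theorem exists_action_of_kernel [∀ x, CompleteSpace (H x)] (h₀ : ∀ x, σ x (RFib.unit x) = 0)
    (hk : ∀ x (γ γ' : RFib x), ‖σ x γ - σ x γ'‖ ^ 2 = ψ (RFib.invMul γ γ'))
    (hd : ∀ x, Dense (Submodule.span ℝ (Set.range (σ x)) : Set (H x))) {x y : X} (γ : x ⟶ y) :
    ∃ A : H x ≃ᵃⁱ[ℝ] H y, ∀ γ', A (σ x γ') = σ y (RFib.lmul γ γ') := by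
  have : Nonempty (RFib x) := ⟨RFib.unit x⟩
  refine exists_affineIsometryEquiv_of_dist_eq (σ x) (fun γ' => σ y (RFib.lmul γ γ'))
    (fun γ₁ γ₂ => ?_) (dense_affineSpan_of_kernel h₀ hd x) ?_
  · rw [← sq_eq_sq₀ dist_nonneg dist_nonneg, dist_eq_norm, dist_eq_norm, hk, hk, RFib.invMul_lmul]
  · have : Set.range (fun γ' => σ y (RFib.lmul γ γ')) = Set.range (σ y) :=
      (RFib.lmul_surjective γ).range_comp (σ y)
    rw [this]
    exact dense_affineSpan_of_kernel h₀ hd y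

variable [TopologicalSpace X] [TopologicalSpace (Arr X)] [IsTopologicalGroupoid X]

theorem continuous_inner_of_kernel (hψ : Continuous ψ) (h₀ : ∀ x, σ x (RFib.unit x) = 0)
    (hk : ∀ x (γ γ' : RFib x), ‖σ x γ - σ x γ'‖ ^ 2 = ψ (RFib.invMul γ γ')) :
    Continuous fun p : TotalSpace (Unit × Unit) ((RFib : X → Type _) ×ᵇ RFib) =>
      inner ℝ (σ p.proj p.snd.1) (σ p.proj p.snd.2) := by
  simp only [inner_of_kernel h₀ hk]
  exact (((hψ.comp (RFib.isInducing_toArr.continuous.comp continuous_fiberProduct_fst)).add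
    (hψ.comp (RFib.isInducing_toArr.continuous.comp continuous_fiberProduct_snd))).sub
    (hψ.comp RFib.continuous_invMul_tot)).div_const 2

/-- Continuity of the action by left translations. -/
theorem continuous_action_of_kernel [T2Space X] [∀ x, CompleteSpace (H x)]
    (hopen : IsOpenMap fun a : Tot (RFib : X → Type _) => a.proj)
    (hψ : Continuous ψ) (h₀ : ∀ x, σ x (RFib.unit x) = 0)
    (hk : ∀ x (γ γ' : RFib x), ‖σ x γ - σ x γ'‖ ^ 2 = ψ (RFib.invMul γ γ'))
    (hd : ∀ x, Dense (Submodule.span ℝ (Set.range (σ x)) : Set (H x)))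
    [t : TopologicalSpace (Tot H)] (ht : t = sectionTopology σ)
    (A : ∀ {x y : X}, (x ⟶ y) → (H x ≃ᵃⁱ[ℝ] H y))
    (hA : ∀ {x y : X} (γ : x ⟶ y) γ', A γ (σ x γ') = σ y (RFib.lmul γ γ')) :
    Continuous fun q : Tot (Arr.src *ᵖ H) => (⟨q.proj.rng, A q.proj.hom q.snd⟩ : Tot H) := by
  have hσ := continuous_inner_of_kernel hψ h₀ hk
  have hV := isHilbertBundle_sectionTopology hopen hσ hd ht
  have hc := continuous_of_sectionTopology hopen RFib.continuous_proj hσ ht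
  refine continuous_iff_continuousAt.mpr fun q₀ => ?_
  obtain ⟨hq, hp⟩ : Tendsto (fun q : Tot (Arr.src *ᵖ H) => q.proj) (𝓝 q₀) (𝓝 q₀.proj) ∧
      Tendsto (fun q : Tot (Arr.src *ᵖ H) => (⟨q.proj.src, q.snd⟩ : Tot H)) (𝓝 q₀)
        (𝓝 ⟨q₀.proj.src, q₀.snd⟩) := by
    have := (inducing_pullbackTotalSpaceEmbedding (F := Unit) (E := H)
      (Arr.src : Arr X → X)).continuous.tendsto q₀
    rw [nhds_prod_eq, tendsto_prod_iff'] at this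
    exact this
  have hr : Tendsto (fun q : Tot (Arr.src *ᵖ H) => q.proj.rng) (𝓝 q₀) (𝓝 q₀.proj.rng) :=
    ((IsTopologicalGroupoid.continuous_rng (X := X)).tendsto _).comp hq
  have hs := hV.tendsto_base hp
  -- Since `A(γ)⁻¹ σ(η) = σ(γ⁻¹η)`, distances from `A(γ) p` to sections become distances in the
  -- source fibre, where continuity is known. Taking `η` a unit gives the norm of `A(γ) p`;
  -- polarisation gives its inner products.
  have hAd : ∀ (γ : Arr X) (p : H γ.src) (η : RFib γ.rng),
      ‖A γ.hom p - σ γ.rng η‖ = ‖p - σ γ.src (RFib.lmul (Groupoid.inv γ.hom) η)‖ := by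
    intro γ p η
    rw [← dist_eq_norm, ← dist_eq_norm, ← (A γ.hom).dist_map, hA, RFib.lmul_inv_lmul]
  have hAn : ∀ (γ : Arr X) (p : H γ.src),
      ‖A γ.hom p‖ = ‖p - σ γ.src (RFib.lmul (Groupoid.inv γ.hom) (RFib.unit γ.rng))‖ := by
    intro γ p
    rw [← hAd, h₀, sub_zero]
  have hAi : ∀ (γ : Arr X) (p : H γ.src) (η : RFib γ.rng),
      inner ℝ (A γ.hom p) (σ γ.rng η) = (‖A γ.hom p‖ ^ 2 + ‖σ γ.rng η‖ ^ 2
        - ‖p - σ γ.src (RFib.lmul (Groupoid.inv γ.hom) η)‖ ^ 2) / 2 := by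
    intro γ p η
    rw [← hAd, @norm_sub_sq_real]
    ring
  have key : ∀ {ι : Type (max u v w)} {l : Filter ι} {g : ι → Tot (Arr.src *ᵖ H)}
      (_ : Tendsto g l (𝓝 q₀)) {η : ∀ i, RFib (g i).proj.rng} {η₀ : RFib q₀.proj.rng}
      (_ : Tendsto (fun i => (η i).toArr) l (𝓝 η₀.toArr)),
      Tendsto (fun i => ‖(show H (g i).proj.src from (g i).snd) -
        σ (g i).proj.src (RFib.lmul (Groupoid.inv (g i).proj.hom) (η i))‖) l
        (𝓝 ‖(show H q₀.proj.src from q₀.snd) -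
          σ q₀.proj.src (RFib.lmul (Groupoid.inv q₀.proj.hom) η₀)‖) := by
    intro ι l g hg η η₀ hη
    refine hV.tendsto_norm (x := fun i => (g i).proj.src) (hV.tendsto_sub (hp.comp hg) ?_)
    refine (hc.tendsto ⟨q₀.proj.src, RFib.lmul (Groupoid.inv q₀.proj.hom) η₀⟩).comp
      (f := fun i => ⟨(g i).proj.src, RFib.lmul (Groupoid.inv (g i).proj.hom) (η i)⟩)
      (RFib.tendsto_iff.mpr ?_)
    simp only [RFib.toArr_lmul_inv]
    exact RFib.tendsto_mul (fun _ => rfl) rfl (RFib.tendsto_inv (hq.comp hg)) hη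
  have hn : Tendsto (fun q : Tot (Arr.src *ᵖ H) => ‖A q.proj.hom q.snd‖) (𝓝 q₀)
      (𝓝 ‖A q₀.proj.hom q₀.snd‖) :=
    Tendsto.congr (fun q => (hAn q.proj q.snd).symm) <| le_trans
      (key tendsto_id (η := fun q => RFib.unit q.proj.rng) (η₀ := RFib.unit q₀.proj.rng)
        (((IsTopologicalGroupoid.continuous_unit (X := X)).tendsto _).comp hr))
      (congrArg 𝓝 (hAn q₀.proj q₀.snd).symm).le
  refine (tendsto_sectionTopology_iff hopen hσ ht).mpr ⟨hr, hn, fun η₀ => ?_⟩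
  have h₁ := tendsto_fst_liftFilter (𝓝 q₀) (fun q : Tot (Arr.src *ᵖ H) => q.proj.rng) η₀
  have h₂ := tendsto_snd_liftFilter (𝓝 q₀) (fun q : Tot (Arr.src *ᵖ H) => q.proj.rng) η₀
  have h := ((((hn.comp h₁).pow 2).add ((hV.tendsto_norm ((hc.tendsto _).comp h₂)).pow 2)).sub
    ((key h₁ (RFib.tendsto_iff.mp h₂)).pow 2)).div_const 2
  exact Tendsto.congr (fun i => (hAi i.1.proj i.1.snd i.2).symm)
    (le_trans h (congrArg 𝓝 (hAi q₀.proj q₀.snd η₀).symm).le)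

/-- The bundle of Hilbert spaces associated with a function conditionally of negative type. -/
theorem exists_generating_section [T2Space X] {ψ : Arr X → ℝ}
    (hopen : IsOpenMap fun a : Tot (RFib : X → Type _) => a.proj)
    (hψ : Continuous ψ) (h : IsCNT ψ) :
    ∃ (E : GAffineHilbertBundle.{u, v, max u v w} X) (e : ∀ x, E.fib x),
      E.IsContinuousSection e ∧ E.Represents e ψ ∧ E.IsGenerating e := by
  have hex : ∀ x : X, ∃ (H : Type (max u v w)) (_ : NormedAddCommGroup H)
      (_ : InnerProductSpace ℝ H) (_ : CompleteSpace H) (σ : RFib x → H), σ (RFib.unit x) = 0 ∧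
      (∀ γ γ', ‖σ γ - σ γ'‖ ^ 2 = ψ (RFib.invMul γ γ')) ∧
      Dense (Submodule.span ℝ (Set.range σ) : Set H) := by
    intro x
    -- Lifting the index set places the Hilbert space in the desired universe.
    have hk : IsCNTKernel fun γ γ' : ULift.{w} (RFib x) => ψ (RFib.invMul γ.down γ'.down) :=
      ⟨fun γ => (h x).diag _, fun γ γ' => (h x).symm _ _, fun n c y => (h x).nonpos n c _⟩
    obtain ⟨H, i₁, i₂, i₃, σ, h₁, h₂, h₃⟩ := hk.exists_hilbert ⟨RFib.unit x⟩
    refine ⟨H, i₁, i₂, i₃, fun γ => σ ⟨γ⟩, h₁, fun γ γ' => h₂ _ _, ?_⟩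
    have : Set.range (fun γ : RFib x => σ ⟨γ⟩) = Set.range σ := 
      Equiv.ulift.symm.surjective.range_comp σ
    rwa [this]
  choose H i₁ i₂ i₃ σ h₀ hk hd using hex
  let t : TopologicalSpace (Tot H) := sectionTopology σ
  choose A hA using fun (x y : X) (γ : x ⟶ y) => exists_action_of_kernel h₀ hk hd γ
  have hσ := continuous_inner_of_kernel hψ h₀ hk
  have hV := isHilbertBundle_sectionTopology hopen hσ hd (t := t) rfl
  have hc := continuous_of_sectionTopology hopen RFib.continuous_proj hσ (t := t) rfl
  have hdd := dense_affineSpan_of_kernel h₀ hd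
  let E : GAffineHilbertBundle.{u, v, max u v w} X :=
    { dir := H
      fib := H
      isAffineHilbertBundle := IsAffineHilbertBundle.of_isHilbertBundle hV
      A := fun {x y} γ => A x y γ
      A_id := fun x p => by
        have : A x x (𝟙 x) = AffineIsometryEquiv.refl ℝ (H x) :=
          AffineIsometryEquiv.ext_of_dense (hdd x) fun γ => by
            rw [hA, RFib.lmul_id, AffineIsometryEquiv.coe_refl, id]
        rw [this, AffineIsometryEquiv.coe_refl, id]
      A_mul := fun {x y z} γ' γ p => by
        have : A x z (γ' ≫ γ) = (A x y γ').trans (A y z γ) :=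
          AffineIsometryEquiv.ext_of_dense (hdd x) fun γ₁ => by
            rw [AffineIsometryEquiv.coe_trans, Function.comp_apply, hA, hA, hA, RFib.lmul_lmul]
        rw [this, AffineIsometryEquiv.coe_trans, Function.comp_apply]
      continuous_A := continuous_action_of_kernel hopen hψ h₀ hk hd (t := t) rfl
        (fun {x y} γ => A x y γ) (fun {x y} γ => hA x y γ) }
  have hAe : ∀ {x : X} (γ : RFib x), A γ.src x γ.hom (σ γ.src (RFib.unit γ.src)) = σ x γ := by
    intro x γ
    rw [hA]
    simp [RFib.lmul, RFib.unit]
  refine ⟨E, fun x => σ x (RFib.unit x), hc.comp RFib.continuous_unit, fun γ => ?_, fun x => ?_⟩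
  · have h1 : A γ.src γ.rng γ.hom (σ γ.src (RFib.unit γ.src)) = σ γ.rng ⟨γ.src, γ.hom⟩ :=
      hAe (x := γ.rng) ⟨γ.src, γ.hom⟩
    change ψ γ = ‖σ γ.rng (RFib.unit γ.rng) - A γ.src γ.rng γ.hom (σ γ.src (RFib.unit γ.src))‖ ^ 2
    rw [h1, hk, RFib.invMul_unit_left]
    rfl
  · have h1 : (fun γ : RFib x => A γ.src x γ.hom (σ γ.src (RFib.unit γ.src))) = σ x :=
      funext fun γ => hAe γ
    change Dense (affineSpan ℝ (Set.range fun γ : RFib x =>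
      A γ.src x γ.hom (σ γ.src (RFib.unit γ.src))) : Set (H x))
    rw [h1]
    exact hdd x

end Construction

/-! ### The integral form of the condition -/

section Integral

variable {X : Type u} [Groupoid.{v} X] [TopologicalSpace X] [TopologicalSpace (Arr X)]
    [IsTopologicalGroupoid X] [T2Space (Arr X)] {ψ : Arr X → ℝ}

/-- With `W = ∫ f σ dλˣ` in the Hilbert space of the kernel, the double integral equals `-2‖W‖²`. -/
theorem IsCNT.isIntegrallyCNT (lam : HaarSystem X) (hψ : Continuous ψ) (h : IsCNT ψ) :
    IsIntegrallyCNT lam ψ where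
  unit x := by
    have := (h x).diag (RFib.unit x)
    rwa [RFib.invMul_self] at this
  symm γ := by
    have := (h γ.rng).symm (RFib.unit γ.rng) ⟨γ.src, γ.hom⟩
    rwa [RFib.invMul_unit_left, RFib.invMul_unit_right] at this
  nonpos x f hf hfc hf₀ := by
    obtain ⟨H, _, _, _, σ, -, hk, -⟩ := (h x).exists_hilbert (RFib.unit x)
    have hσ : Continuous σ := by
      refine continuous_iff_continuousAt.mpr fun γ₀ => tendsto_iff_norm_sub_tendsto_zero.mpr ?_
      have h1 : Continuous fun γ : RFib x => ψ (RFib.invMul γ γ₀) :=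
        hψ.comp (RFib.continuous_invMul.comp (continuous_id.prodMk continuous_const))
      have h2 := (h1.tendsto γ₀).sqrt
      rw [(h x).diag, Real.sqrt_zero] at h2
      simpa only [← hk, Real.sqrt_sq (norm_nonneg _)] using h2
    set μ := lam.meas x
    set g : RFib x → ℝ := fun γ => f γ.toArr with hg
    have hgc : Continuous g := hf.comp RFib.continuous_toArr
    have hgs : HasCompactSupport g := hfc.comp_toArr x
    have i₁ : Integrable g μ := lam.integrable hgc hgs
    have i₂ : Integrable (fun γ => g γ • σ γ) μ :=
      lam.integrable (hgc.smul hσ) hgs.smul_right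
    have i₃ : Integrable (fun γ => g γ * ‖σ γ‖ ^ 2) μ :=
      lam.integrable (hgc.mul (hσ.norm.pow 2)) hgs.mul_right
    set W := ∫ γ, g γ • σ γ ∂μ with hW
    set C := ∫ γ, g γ * ‖σ γ‖ ^ 2 ∂μ with hC
    -- The term in `‖σ γ‖²` vanishes because `∫ g = 0`; the term with `C` vanishes in the outer
    -- integral for the same reason.
    have h1 : ∀ γ, ∫ γ', ψ (RFib.invMul γ γ') * g γ * g γ' ∂μ
        = C * g γ - 2 * inner ℝ W (g γ • σ γ) := by
      intro γ
      have e : ∀ γ', ψ (RFib.invMul γ γ') * g γ * g γ' = (‖σ γ‖ ^ 2 * g γ) * g γ'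
          - (2 * g γ) * inner ℝ (σ γ) (g γ' • σ γ') + g γ * (g γ' * ‖σ γ'‖ ^ 2) := by
        intro γ'
        rw [← hk, @norm_sub_sq_real, real_inner_smul_right]
        ring
      simp only [e]
      have i₄ : Integrable (fun γ' => (‖σ γ‖ ^ 2 * g γ) * g γ'
          - (2 * g γ) * inner ℝ (σ γ) (g γ' • σ γ')) μ :=
        (i₁.const_mul _).sub ((i₂.const_inner _).const_mul _)
      rw [integral_add i₄ (i₃.const_mul _),
        integral_sub (i₁.const_mul _) ((i₂.const_inner _).const_mul _), integral_const_mul,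
        integral_const_mul, integral_const_mul, integral_inner i₂, hf₀, ← hC, ← hW,
        real_inner_smul_right, real_inner_comm]
      ring
    change ∫ γ, ∫ γ', ψ (RFib.invMul γ γ') * g γ * g γ' ∂μ ∂μ ≤ 0
    simp only [h1]
    rw [integral_sub (i₁.const_mul _) ((i₂.const_inner _).const_mul _), integral_const_mul,
      integral_const_mul, integral_inner i₂, hf₀, ← hW]
    have := real_inner_self_nonneg (x := W)
    linarith

/-- An average of a function close to `c` is close to `c`. -/
theorem abs_integral_mul_sub_le {Y : Type*} [MeasurableSpace Y] {μ : Measure Y} {φ g : Y → ℝ}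
    (hg : Integrable g μ) (h₀ : ∀ y, 0 ≤ g y) (h₁ : ∫ y, g y ∂μ = 1)
    (hφ : Integrable (fun y => φ y * g y) μ) {c ε : ℝ} (h : ∀ y, g y ≠ 0 → |φ y - c| ≤ ε) :
    |∫ y, φ y * g y ∂μ - c| ≤ ε := by
  have e : ∫ y, φ y * g y ∂μ - c = ∫ y, (φ y * g y - c * g y) ∂μ := by
    rw [integral_sub hφ (hg.const_mul c), integral_const_mul, h₁, mul_one]
  have e' : ε = ∫ y, ε * g y ∂μ := by rw [integral_const_mul, h₁, mul_one]
  rw [e, e', ← Real.norm_eq_abs]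
  refine norm_integral_le_of_norm_le (hg.const_mul ε) (Eventually.of_forall fun y => ?_)
  rw [← sub_mul, norm_mul, Real.norm_eq_abs, Real.norm_of_nonneg (h₀ y)]
  rcases eq_or_ne (g y) 0 with hy | hy
  · simp [hy]
  · exact mul_le_mul_of_nonneg_right (h y hy) (h₀ y)

variable [LocallyCompactSpace (Arr X)] [SecondCountableTopology (Arr X)]

/-- Needed for the outer integrals in the converse implication to be integrals of continuous,
compactly supported functions. -/
theorem continuous_integral_kernel (lam : HaarSystem X) (hψ : Continuous ψ) {x : X}
    {g : RFib x → ℝ} (hg : Continuous g) (hgc : HasCompactSupport g) :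
    Continuous fun γ : RFib x => ∫ γ', ψ (RFib.invMul γ γ') * g γ' ∂(lam.meas x) := by
  have : SecondCountableTopology (RFib x) := RFib.isEmbedding_toArr.secondCountableTopology
  have : LocallyCompactSpace (RFib x) := RFib.isClosedEmbedding_toArr.locallyCompactSpace
  have := lam.finite_on_compacts x
  have h := continuous_parametric_integral_of_continuous (μ := lam.meas x)
    (f := fun γ γ' : RFib x => ψ (RFib.invMul γ γ') * g γ')
    ((hψ.comp RFib.continuous_invMul).mul (hg.comp continuous_snd)) hgc
  refine h.congr fun γ => setIntegral_eq_integral_of_forall_compl_eq_zero fun γ' hγ' => ?_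
  rw [image_eq_zero_of_notMem_tsupport hγ', mul_zero]

/-- Test the integral inequality on `∑ c i * f i`, with `f i` a bump of integral one concentrated
near `y i`: the double integral is then close to the discrete sum. -/
theorem IsIntegrallyCNT.isCNT {lam : HaarSystem X} (hψ : Continuous ψ)
    (h : IsIntegrallyCNT lam ψ) : IsCNT ψ := by
  refine fun x => ⟨fun γ => ?_, fun γ γ' => ?_, fun n c y hc => ?_⟩
  · rw [RFib.invMul_self, h.unit]
  · rw [RFib.invMul_symm, h.symm]
  set k : RFib x → RFib x → ℝ := fun γ γ' => ψ (RFib.invMul γ γ') with hk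
  have hkc : Continuous fun p : RFib x × RFib x => k p.1 p.2 := hψ.comp RFib.continuous_invMul
  set M := ∑ i, ∑ j, |c i * c j| with hM
  have hM0 : 0 ≤ M := Finset.sum_nonneg fun i _ => Finset.sum_nonneg fun j _ => abs_nonneg _
  refine le_of_forall_pos_le_add fun δ hδ => ?_
  rw [zero_add]
  -- The total error is at most `ε * M ≤ δ`; the added `1` covers `M = 0`.
  set ε := δ / (M + 1) with hε
  have hε0 : 0 < ε := by positivity
  have hεM : ε * M ≤ δ := by
    rw [hε, div_mul_eq_mul_div, div_le_iff₀ (by positivity)]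
    nlinarith
  set μ := lam.meas x
  obtain ⟨U, hU, hUk⟩ : ∃ U : Fin n → Set (RFib x), (∀ i, U i ∈ 𝓝 (y i)) ∧
      ∀ i j, ∀ γ ∈ U i, ∀ γ' ∈ U j, |k γ γ' - k (y i) (y j)| ≤ ε := by
    have h1 : ∀ i j, ∃ P ∈ 𝓝 (y i), ∃ Q ∈ 𝓝 (y j), ∀ γ ∈ P, ∀ γ' ∈ Q,
        |k γ γ' - k (y i) (y j)| ≤ ε := by
      intro i j
      have h2 := Metric.tendsto_nhds.mp (hkc.tendsto (y i, y j)) ε hε0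
      rw [nhds_prod_eq] at h2
      obtain ⟨P, hP, Q, hQ, hPQ⟩ := mem_prod_iff.mp h2
      exact ⟨P, hP, Q, hQ, fun γ hγ γ' hγ' => (hPQ (Set.mk_mem_prod hγ hγ')).le⟩
    choose P hP Q hQ hPQ using h1
    -- Each `y i` needs one neighbourhood serving it as first and as second argument, against every
    -- `y j`.
    refine ⟨fun i => (⋂ j, P i j) ∩ ⋂ j, Q j i, fun i => inter_mem (iInter_mem.mpr fun j => hP i j)
      (iInter_mem.mpr fun j => hQ j i), fun i j γ hγ γ' hγ' => hPQ i j γ ?_ γ' ?_⟩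
    · exact Set.mem_iInter.mp hγ.1 j
    · exact Set.mem_iInter.mp hγ'.2 i
  have hf : ∀ i, ∃ f : Arr X → ℝ, Continuous f ∧ HasCompactSupport f ∧ (∀ γ, 0 ≤ f γ) ∧
      ∫ γ, f (RFib.toArr γ) ∂μ = 1 ∧ ∀ γ : RFib x, f γ.toArr ≠ 0 → γ ∈ U i := by
    intro i
    have hUi := hU i
    rw [RFib.isEmbedding_toArr.isInducing.nhds_eq_comap] at hUi
    obtain ⟨O, hO, hOU⟩ := mem_comap.mp hUi
    obtain ⟨f, f1, f2, f3, f4, f5⟩ := exists_continuous_bump _ hO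
    have hpos := lam.integral_pos f1 f2 f3 f4
    set I := ∫ γ, f (RFib.toArr γ) ∂μ
    refine ⟨fun γ => I⁻¹ * f γ, continuous_const.mul f1, f2.mul_left,
      fun γ => mul_nonneg (inv_nonneg.mpr hpos.le) (f3 γ), ?_, fun γ hγ =>
        hOU (f5 _ (right_ne_zero_of_mul hγ))⟩
    rw [integral_const_mul]
    exact inv_mul_cancel₀ hpos.ne'
  choose f f1 f2 f3 f4 f5 using hf
  set g : Fin n → RFib x → ℝ := fun i γ => f i γ.toArr with hg
  have g1 : ∀ i, Continuous (g i) := fun i => (f1 i).comp RFib.continuous_toArr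
  have g2 : ∀ i, HasCompactSupport (g i) := fun i => (f2 i).comp_toArr x
  set I : Fin n → RFib x → ℝ := fun j γ => ∫ γ', k γ γ' * g j γ' ∂μ with hI
  have hIc : ∀ j, Continuous (I j) := fun j => continuous_integral_kernel lam hψ (g1 j) (g2 j)
  have ig : ∀ i, Integrable (g i) μ := fun i => lam.integrable (g1 i) (g2 i)
  have ik : ∀ γ j, Integrable (fun γ' => k γ γ' * g j γ') μ := fun γ j =>
    lam.integrable ((hkc.comp (continuous_const.prodMk continuous_id)).mul (g1 j)) (g2 j).mul_left
  have iI : ∀ i j, Integrable (fun γ => I j γ * g i γ) μ := fun i j =>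
    lam.integrable ((hIc j).mul (g1 i)) (g2 i).mul_left
  have hI1 : ∀ i j γ, γ ∈ U i → |I j γ - k (y i) (y j)| ≤ ε := fun i j γ hγ =>
    abs_integral_mul_sub_le (ig j) (fun _ => f3 _ _) (f4 j) (ik γ j)
      fun γ' hγ' => hUk i j γ hγ γ' (f5 j γ' hγ')
  have hJ : ∀ i j, |∫ γ, I j γ * g i γ ∂μ - k (y i) (y j)| ≤ ε := fun i j =>
    abs_integral_mul_sub_le (ig i) (fun _ => f3 _ _) (f4 i) (iI i j)
      fun γ hγ => hI1 i j γ (f5 i γ hγ)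
  have hF := h.nonpos x (fun γ => ∑ i, c i * f i γ)
    (continuous_finsetSum _ fun i _ => continuous_const.mul (f1 i)) ?_ ?_
  · have e1 : ∀ γ, ∫ γ', ψ (RFib.invMul γ γ') * (∑ i, c i * f i γ.toArr) *
        (∑ j, c j * f j (RFib.toArr γ')) ∂μ = ∑ i, ∑ j, c i * c j * (I j γ * g i γ) := by
      intro γ
      have e2 : ∀ γ', ψ (RFib.invMul γ γ') * (∑ i, c i * f i γ.toArr) *
          (∑ j, c j * f j (RFib.toArr γ'))
          = ∑ i, ∑ j, (c i * c j * g i γ) * (k γ γ' * g j γ') := by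
        intro γ'
        rw [mul_assoc, Finset.sum_mul_sum, Finset.mul_sum]
        refine Finset.sum_congr rfl fun i _ => ?_
        rw [Finset.mul_sum]
        exact Finset.sum_congr rfl fun j _ => by simp only [hg, hk]; ring
      simp only [e2]
      rw [integral_finsetSum _ fun i _ => integrable_finsetSum _ fun j _ =>
        (ik γ j).const_mul _]
      refine Finset.sum_congr rfl fun i _ => ?_
      rw [integral_finsetSum _ fun j _ => (ik γ j).const_mul _]
      refine Finset.sum_congr rfl fun j _ => ?_
      rw [integral_const_mul]
      simp only [hI]
      ring
    replace hF : ∫ γ, ∫ γ', ψ (RFib.invMul γ γ') * (∑ i, c i * f i γ.toArr) *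
        (∑ j, c j * f j (RFib.toArr γ')) ∂μ ∂μ ≤ 0 := hF
    simp only [e1] at hF
    rw [integral_finsetSum _ fun i _ => integrable_finsetSum _ fun j _ =>
      (iI i j).const_mul _] at hF
    have e3 : ∀ i, ∫ γ, ∑ j, c i * c j * (I j γ * g i γ) ∂μ
        = ∑ j, c i * c j * ∫ γ, I j γ * g i γ ∂μ := by
      intro i
      rw [integral_finsetSum _ fun j _ => (iI i j).const_mul _]
      simp only [integral_const_mul]
    simp only [e3] at hF
    -- Each discrete term differs from its averaged counterpart by at most `ε * |c i * c j|`.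
    have e4 : ∑ i, ∑ j, k (y i) (y j) * c i * c j ≤
        ∑ i, ∑ j, (c i * c j * ∫ γ, I j γ * g i γ ∂μ + ε * |c i * c j|) := by
      refine Finset.sum_le_sum fun i _ => Finset.sum_le_sum fun j _ => ?_
      have e5 : |c i * c j * (k (y i) (y j) - ∫ γ, I j γ * g i γ ∂μ)| ≤ ε * |c i * c j| := by
        rw [abs_mul, mul_comm, abs_sub_comm]
        exact mul_le_mul_of_nonneg_right (hJ i j) (abs_nonneg _)
      have := (abs_le.mp e5).2
      linarith
    simp only [Finset.sum_add_distrib, ← Finset.mul_sum] at e4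
    rw [← hM] at e4
    linarith
  · rw [← Finset.sum_fn]
    exact Finset.sum_induction _ HasCompactSupport (fun _ _ h h' => h.add h') HasCompactSupport.zero
      fun i _ => (f2 i).mul_left
  · change ∫ γ, ∑ i, c i * g i γ ∂μ = 0
    rw [integral_finsetSum _ fun i _ => (ig i).const_mul _]
    simp only [integral_const_mul, show ∀ i, ∫ γ, g i γ ∂μ = 1 from f4, mul_one, hc]

end Integral

theorem mainTheorem2 {X : Type u} [Groupoid.{v} X] [TopologicalSpace X] [TopologicalSpace (Arr X)]
    [IsTopologicalGroupoid X] [LocallyCompactSpace (Arr X)] [T2Space (Arr X)]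
    [SecondCountableTopology (Arr X)] (lam : HaarSystem X) (ψ : Arr X → ℝ) (hψ : Continuous ψ) :
    List.TFAE
      [IsCNT ψ,
       IsIntegrallyCNT lam ψ,
       ∃ (E : GAffineHilbertBundle.{u, v, max u v w} X) (e : ∀ x, E.fib x),
          E.IsContinuousSection e ∧ E.Represents e ψ] ∧
    (IsCNT ψ →
      (∃ (E : GAffineHilbertBundle.{u, v, max u v w} X) (e : ∀ x, E.fib x),
          E.IsContinuousSection e ∧ E.Represents e ψ ∧ E.IsGenerating e) ∧
      ∀ (E : GAffineHilbertBundle.{u, v, w₁} X) (e : ∀ x, E.fib x)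
        (E' : GAffineHilbertBundle.{u, v, w₂} X) (e' : ∀ x, E'.fib x),
          E.IsContinuousSection e → E.Represents e ψ → E.IsGenerating e →
          E'.IsContinuousSection e' → E'.Represents e' ψ → E'.IsGenerating e' →
          ∃! φ : GAffineHilbertBundle.Iso E E', ∀ x, φ.map x (e x) = e' x) := by
  have := IsTopologicalGroupoid.t2Space_units X
  have hopen := lam.isOpenMap_proj
  refine ⟨?_, fun h => ⟨exists_generating_section.{u, v, w} hopen hψ h,
    fun E e E' e' hc hr hg hc' hr' hg' =>
      GAffineHilbertBundle.existsUnique_iso hopen hc hr hg hc' hr' hg'⟩⟩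
  tfae_have 1 → 2 := fun h => h.isIntegrallyCNT lam hψ
  tfae_have 2 → 1 := fun h => h.isCNT hψ
  tfae_have 1 → 3 := fun h => by
    obtain ⟨E, e, hc, hr, -⟩ := exists_generating_section.{u, v, w} hopen hψ h
    exact ⟨E, e, hc, hr⟩
  tfae_have 3 → 1 := fun ⟨_, _, _, hr⟩ => hr.isCNT
  tfae_finish
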